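/- Let $d\in\{2,3\}$ and let $\Omega\subset\mathbb{R}^d$ be an open, bounded, connected set with Lipschitz boundary. Let $\mathbf{H}_0(\operatorname{div},\Omega)$ be the space of fields in $\mathbf{L}^2(\Omega)$ with weak divergence in $L^2(\Omega)$ and vanishing normal trace on $\partial\Omega$ (that is, $\int_\Omega \mathbf u\cdot\nabla\varphi+\int_\Omega(\nabla\cdot\mathbf u)\,\varphi=0$ for all $\varphi\in H^1(\Omega)$), with norm $\|\mathbf u\|_{\operatorname{div},\Omega}^2=\|\mathbf u\|_{0,\Omega}^2+\|\nabla\cdot\mathbf u\|_{0,\Omega}^2$, where $\|\cdot\|_{0,\Omega}$ is the $L^2(\Omega)$ norm. Let $\Pi_{\mathbb R}p=\frac1{|\Omega|}\int_\Omega p$ be the projection onto constants. For a subspace $Q\subseteq L^2(\Omega)$ with norm $\|q\|_Q^2=\|q\|_{0,\Omega}^2+\|q\|_{0,\Omega}^2$, put $\|f\|_{Q'}=\sup_{0\ne q\in Q}\frac{|\int_\Omega f q|}{\|q\|_Q}$. There is a constant $C>0$, depending only on $\Omega$, such that for every $\alpha\in[0,1]$ and every $f\in L^2(\Omega)$ there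 is a unique pair $(\mathbf u,p)\in \mathbf{H}_0(\operatorname{div},\Omega)\times L^2(\Omega)$ with $$\int_\Omega \mathbf u\cdot\mathbf v-\int_\Omega p\,\nabla\cdot\mathbf v=0\quad\forall\,\mathbf v\in\mathbf{H}_0(\operatorname{div},\Omega),$$ $$\int_\Omega(\nabla\cdot\mathbf u)\,q+\int_\Omega\bigl(\alpha p+(1-\alpha)\Pi_{\mathbb R}p\bigr)q=\int_\Omega f q\quad\forall\,q\in L^2(\Omega),$$ and this pair satisfies $$\|\mathbf u\|_{\operatorname{div},\Omega}+(1+\sqrt\alpha)\,\|p\|_{0,\Omega}\le C\,\|f\|_{Q'}\qquad\text{with } Q=L^2(\Omega).$$ If moreover $\int_\Omega f=0$, the same bound holds with $Q=\{q\in L^2(\Omega):\int_\Omega q=0\}\cong L^2(\Omega)/\mathbb R$. -/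

import Mathlib

open MeasureTheory
open scoped ContDiff

noncomputable section

namespace MixedNeumann

/-- Euclidean space `ℝ^d` with its Euclidean norm. -/
abbrev E (d : ℕ) : Type := EuclideanSpace ℝ (Fin d)

/-- The space `L²(Ω)` of scalar functions, up to equality almost everywhere. -/
abbrev L2 {d : ℕ} (Ω : Set (E d)) : Type := Lp ℝ 2 (volume.restrict Ω)

/-- The space `L²(Ω; ℝ^d)` of vector fields, up to equality almost everywhere. -/
abbrev L2Vec {d : ℕ} (Ω : Set (E d)) : Type := Lp (E d) 2 (volume.restrict Ω)

/-- Lipschitz boundary: near each boundary point, in suitable orthonormal coordinates, the set is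
the strict epigraph of a Lipschitz function. Here `ν` is the last coordinate direction,
`y - ⟪ν, y⟫ ν` is the projection of `y` to the hyperplane orthogonal to `ν`, and only the values
of `γ` on that hyperplane matter. -/
def HasLipschitzBoundary {d : ℕ} (Ω : Set (E d)) : Prop :=
  ∀ x ∈ frontier Ω, ∃ (ν : E d) (γ : E d → ℝ) (K : NNReal) (r : ℝ),
    ‖ν‖ = 1 ∧ LipschitzWith K γ ∧ 0 < r ∧
      ∀ y ∈ Metric.ball x r, (y ∈ Ω ↔ γ (y - inner ℝ ν y • ν) < inner ℝ ν y)

/-- An open, bounded, connected (in particular nonempty) set with Lipschitz boundary. -/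
structure IsLipschitzDomain {d : ℕ} (Ω : Set (E d)) : Prop where
  isOpen : IsOpen Ω
  isBounded : Bornology.IsBounded Ω
  isConnected : IsConnected Ω
  lipschitz : HasLipschitzBoundary Ω

/-- Test functions: smooth functions with compact support in `Ω`. -/
def IsTest {d : ℕ} (Ω : Set (E d)) (φ : E d → ℝ) : Prop :=
  ContDiff ℝ ∞ φ ∧ HasCompactSupport φ ∧ tsupport φ ⊆ Ω

/-- `g ∈ L²(Ω)` is the weak divergence of the vector field `u` on `Ω`. -/
def IsWeakDiv {d : ℕ} (Ω : Set (E d)) (u : L2Vec Ω) (g : L2 Ω) : Prop :=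
  ∀ φ : E d → ℝ, IsTest Ω φ →
    ∫ x in Ω, inner ℝ (u x) (gradient φ x) = -∫ x in Ω, g x * φ x

/-- `G ∈ L²(Ω; ℝ^d)` is the weak gradient of `p ∈ L²(Ω)`; thus `p ∈ H¹(Ω)` means that such a
`G` exists. -/
def IsWeakGrad {d : ℕ} (Ω : Set (E d)) (p : L2 Ω) (G : L2Vec Ω) : Prop :=
  ∀ φ : E d → ℝ, IsTest Ω φ → ∀ i : Fin d,
    ∫ x in Ω, p x * gradient φ x i = -∫ x in Ω, G x i * φ x

/-- On an open set the weak divergence is unique, so that `weakDiv` below is well defined. -/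
theorem IsWeakDiv.unique {d : ℕ} {Ω : Set (E d)} (hΩ : IsOpen Ω) {u : L2Vec Ω} {g g' : L2 Ω}
    (h : IsWeakDiv Ω u g) (h' : IsWeakDiv Ω u g') : g = g' := by
  have hloc : ∀ k : L2 Ω, LocallyIntegrable k (volume.restrict Ω) := fun k =>
    (Lp.memLp k).locallyIntegrable (by norm_num)
  have key : ∀ᵐ x, x ∈ Ω → (g x - g' x) = 0 := by
    refine hΩ.ae_eq_zero_of_integral_contDiff_smul_eq_zero (f := fun x => g x - g' x) ?_ ?_
    · refine (locallyIntegrableOn_of_locallyIntegrable_restrict ?_)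
      exact (hloc g).sub (hloc g')
    · intro φ hφ hc hs
      have hz : ∀ x, x ∉ Ω → φ x • (g x - g' x) = 0 := fun x hx => by
        rw [image_eq_zero_of_notMem_tsupport (fun hx' => hx (hs hx')), zero_smul]
      rw [← setIntegral_eq_integral_of_forall_compl_eq_zero hz]
      have hi : ∀ k : L2 Ω, Integrable (fun x => k x * φ x) (volume.restrict Ω) := fun k => by
        have := (hloc k).integrable_smul_left_of_hasCompactSupport hφ.continuous hc
        simpa [mul_comm] using this
      have e := (h φ ⟨hφ, hc, hs⟩).symm.trans (h' φ ⟨hφ, hc, hs⟩)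
      have : (fun x => φ x • (g x - g' x)) = fun x => g x * φ x - g' x * φ x := by
        funext x; simp only [smul_eq_mul]; ring
      rw [this, integral_sub (hi g) (hi g')]
      linarith
  apply Lp.ext
  filter_upwards [(ae_restrict_iff' hΩ.measurableSet).2 key] with x hx
  linarith

open Classical in
/-- The weak divergence of `u ∈ H(div, Ω)` (and `0` for other `u`). -/
def weakDiv {d : ℕ} (Ω : Set (E d)) (u : L2Vec Ω) : L2 Ω :=
  if h : ∃ g : L2 Ω, IsWeakDiv Ω u g then h.choose else 0

/-- The space `H(div, Ω)` of square integrable fields with square integrable weak divergence. -/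
def HDiv {d : ℕ} (Ω : Set (E d)) : Set (L2Vec Ω) :=
  {u | ∃ g : L2 Ω, IsWeakDiv Ω u g}

/-- The space `H₀(div, Ω)` of the fields `u ∈ H(div, Ω)` with vanishing normal trace on `∂Ω`. The
normal trace is the functional `φ ↦ ∫ u · ∇φ + ∫ (div u) φ` on `H¹(Ω)` (Green's formula). -/
def HDivZero {d : ℕ} (Ω : Set (E d)) : Set (L2Vec Ω) :=
  {u | u ∈ HDiv Ω ∧ ∀ (φ : L2 Ω) (G : L2Vec Ω), IsWeakGrad Ω φ G →
    (∫ x in Ω, inner ℝ (u x) (G x)) + ∫ x in Ω, weakDiv Ω u x * φ x = 0}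

/-- The norm of `H(div, Ω)`. -/
def divNorm {d : ℕ} (Ω : Set (E d)) (u : L2Vec Ω) : ℝ :=
  Real.sqrt (‖u‖ ^ 2 + ‖weakDiv Ω u‖ ^ 2)

/-- The projection of `p` onto the constants: the constant function with the mean value of `p`. -/
def projConst {d : ℕ} (Ω : Set (E d)) (p : L2 Ω) : E d → ℝ :=
  fun _ => ⨍ y in Ω, p y

/-- The functions in `L²(Ω)` with zero mean, that is `L²(Ω) / ℝ`. -/
def zeroMean {d : ℕ} (Ω : Set (E d)) : Set (L2 Ω) :=
  {q | ⨍ y in Ω, q y = 0}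

/-- `(u, p) ∈ H₀(div, Ω) × L²(Ω)` solves, in the weak sense, the mixed system
`u + ∇ p = 0`, `∇ · u + (α I + (1 - α) Π) p = f`, with `Π` the projection onto constants; here
`∇ : L²(Ω) → H₀(div, Ω)'` is the negative adjoint of the divergence. -/
structure IsSolution {d : ℕ} (Ω : Set (E d)) (α : ℝ) (f : L2 Ω) (u : L2Vec Ω) (p : L2 Ω) :
    Prop where
  mem : u ∈ HDivZero Ω
  first : ∀ v ∈ HDivZero Ω,
    (∫ x in Ω, inner ℝ (u x) (v x)) - ∫ x in Ω, p x * weakDiv Ω v x = 0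
  second : ∀ q : L2 Ω,
    (∫ x in Ω, weakDiv Ω u x * q x)
      + ∫ x in Ω, (α * p x + (1 - α) * projConst Ω p x) * q x = ∫ x in Ω, f x * q x

/-- The norm of the pressure space: `‖q‖_Q² = ‖q‖_b² + |q|_c²`, where both `‖·‖_b` and `|·|_c` are
the norm of `L²(Ω)`. -/
def qNorm {d : ℕ} (Ω : Set (E d)) (q : L2 Ω) : ℝ :=
  Real.sqrt (‖q‖ ^ 2 + ‖q‖ ^ 2)

/-- The norm of `f` in the dual of a subspace `Q` of `L²(Ω)` that carries the norm `qNorm`. -/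
def dualNorm {d : ℕ} (Ω : Set (E d)) (Q : Set (L2 Ω)) (f : L2 Ω) : ℝ :=
  sSup {t : ℝ | ∃ q ∈ Q, q ≠ 0 ∧ t = |∫ x in Ω, f x * q x| / qNorm Ω q}

end MixedNeumann

end

/-!
The pressure of a solution is a function in `H¹(Ω)` with `∇p = -u` (test the first equation with
the fields `φ eᵢ`), and the pair `(p, ∇p)` solves the variational problem
`∫ ∇p · ∇q + ∫ (α p + (1 - α) Π p) q = ∫ f q` on `H¹(Ω)`; conversely, the variational equation says
exactly that `u = -∇p` has vanishing normal trace and divergence `f - α p - (1 - α) Π p`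
(`isSolution_iff`, `mem_HDivZero_iff`). Since `⟪α p + (1 - α) Π p, p⟫ ≥ ‖Π p‖²` for `α ∈ [0, 1]`,
the Poincaré inequality `‖p‖² ≤ C ‖∇p‖² + ‖Π p‖²` makes the bilinear form coercive uniformly in `α`.
Lax-Milgram gives existence and uniqueness, and testing with `p` gives the bound by `‖f‖`. The dual
norms of `f` over `L²(Ω)` and, for `f` of zero mean, over the functions of zero mean are both
equivalent to `‖f‖`, because `f` itself is admissible in the supremum.

The Poincaré inequality for weak gradients on a Lipschitz domain (`exists_poincare`) is proved in
the form `∫_A ∫_B |p(y) - p(z)|² dz dy ≤ C ∫_Ω |∇p|²` (`PairPoincare`).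
* If all segments between `A` and `B` run inside `Ω`, one integrates the gradient of a mollification
  along the segments. Changing variables in the endpoint that is farther from the current point
  costs only a factor `2^d` (`lintegral_segment_le`), and Fatou's lemma removes the mollification
  (`pairPoincare_of_segment_subset`).
* Near a boundary point, the points of `Ω` all see a common ball inside `Ω`
  (`exists_visible_ball`); this is where the Lipschitz condition enters.
* The inequality is symmetric, and transitive through sets of positive measure, so connectedness
  and compactness of the closure of `Ω` extend it to `A = B = Ω` (`pairPoincare_self`).
-/

namespace MixedNeumann

open Set Filter Topology
open scoped ENNReal NNReal Convolution

variable {d : ℕ} {Ω : Set (E d)}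

/-! ### Integrals along segments -/

/-- Jensen's inequality for the square, on a probability space. -/
theorem sq_lintegral_le {α : Type*} [MeasurableSpace α] (ν : Measure α) [IsProbabilityMeasure ν]
    {f : α → ℝ≥0∞} (hf : AEMeasurable f ν) : (∫⁻ x, f x ∂ν) ^ 2 ≤ ∫⁻ x, f x ^ 2 ∂ν := by
  have h := ENNReal.lintegral_mul_le_Lp_mul_Lq ν Real.HolderConjugate.two_two hf
    (aemeasurable_const (b := (1 : ℝ≥0∞)))
  simp only [Pi.mul_apply, mul_one, ENNReal.rpow_ofNat, one_pow, lintegral_const, measure_univ,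
    ENNReal.one_rpow, one_div] at h
  calc (∫⁻ x, f x ∂ν) ^ 2 ≤ ((∫⁻ x, f x ^ 2 ∂ν) ^ (2⁻¹ : ℝ)) ^ 2 := by gcongr
    _ = ∫⁻ x, f x ^ 2 ∂ν := by
      rw [← ENNReal.rpow_natCast, ← ENNReal.rpow_mul]; norm_num

theorem lintegral_comp_add_smul {g : E d → ℝ≥0∞} (hg : Measurable g) (a : E d) {r : ℝ}
    (hr : 1 / 2 ≤ r) : ∫⁻ x, g (a + r • x) ≤ 2 ^ d * ∫⁻ x, g x := by
  have hr0 : 0 < r := by linarith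
  have h1 : ∫⁻ x, g (a + r • x) = ∫⁻ x, g (a + x) ∂(Measure.map (r • ·) volume) := by
    rw [lintegral_map (by fun_prop) (by fun_prop)]
  rw [h1, Measure.map_addHaar_smul _ hr0.ne', lintegral_smul_measure, lintegral_add_left_eq_self,
    smul_eq_mul]
  gcongr
  rw [finrank_euclideanSpace_fin, abs_of_pos (by positivity), ← inv_pow,
    ENNReal.ofReal_pow (by positivity)]
  gcongr
  rw [show (2 : ℝ≥0∞) = ENNReal.ofReal 2 by simp]
  apply ENNReal.ofReal_le_ofReal
  rw [inv_le_comm₀ hr0 (by norm_num)]; linarith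

/-- The average of `g` over all segments between `A` and `B` is controlled by the integral of `g`
alone: on the half `t ≥ 1/2` of a segment the substitution `x = y + t (z - y)` is made in `z`, on
the half `t ≤ 1/2` in `y`, so that the Jacobian stays above `2^(-d)`. -/
theorem lintegral_segment_le {g : E d → ℝ≥0∞} (hg : Measurable g) (A B : Set (E d)) :
    ∫⁻ y in A, ∫⁻ z in B, ∫⁻ t in Ioc (0 : ℝ) 1, g (y + t • (z - y))
      ≤ 2 ^ d * (volume A + volume B) * ∫⁻ x, g x := by
  have hI : ∀ S : Set ℝ, Measurable fun q : E d × E d => ∫⁻ t in S, g (q.1 + t • (q.2 - q.1)) :=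
    fun S => Measurable.lintegral_prod_right'
      (f := fun q : (E d × E d) × ℝ => g (q.1.1 + q.2 • (q.1.2 - q.1.1))) (by fun_prop)
  have hsplit : ∀ y z : E d, ∫⁻ t in Ioc (0 : ℝ) 1, g (y + t • (z - y)) ≤
      (∫⁻ t in Ioc (0 : ℝ) (1 / 2), g (y + t • (z - y)))
        + ∫⁻ t in Ioc (1 / 2 : ℝ) 1, g (y + t • (z - y)) := fun y z => by
    rw [← Ioc_union_Ioc_eq_Ioc (b := (1 / 2 : ℝ)) (by norm_num) (by norm_num)]
    exact lintegral_union_le _ _ _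
  have hvol : ∀ a b : ℝ, b - a = 1 / 2 → volume (Ioc a b) ≤ 1 := fun a b h => by
    rw [Real.volume_Ioc, h]; simp
  have hfar : ∀ y : E d, ∫⁻ z in B, ∫⁻ t in Ioc (1 / 2 : ℝ) 1, g (y + t • (z - y))
      ≤ 2 ^ d * ∫⁻ x, g x := fun y => by
    rw [lintegral_lintegral_swap (by fun_prop)]
    calc ∫⁻ t in Ioc (1 / 2 : ℝ) 1, ∫⁻ z in B, g (y + t • (z - y))
        ≤ ∫⁻ t in Ioc (1 / 2 : ℝ) 1, 2 ^ d * ∫⁻ x, g x := by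
          refine setLIntegral_mono measurable_const fun t ht => ?_
          refine (lintegral_mono' Measure.restrict_le_self le_rfl).trans ?_
          refine le_trans (le_of_eq ?_) (lintegral_comp_add_smul hg (y - t • y) ht.1.le)
          congr with z
          congr 1
          module
      _ ≤ 2 ^ d * ∫⁻ x, g x := by
          rw [setLIntegral_const]
          exact mul_le_of_le_one_right' (hvol _ _ (by norm_num))
  have hnear : ∀ z : E d, ∫⁻ y in A, ∫⁻ t in Ioc (0 : ℝ) (1 / 2), g (y + t • (z - y))
      ≤ 2 ^ d * ∫⁻ x, g x := fun z => by
    rw [lintegral_lintegral_swap (by fun_prop)]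
    calc ∫⁻ t in Ioc (0 : ℝ) (1 / 2), ∫⁻ y in A, g (y + t • (z - y))
        ≤ ∫⁻ t in Ioc (0 : ℝ) (1 / 2), 2 ^ d * ∫⁻ x, g x := by
          refine setLIntegral_mono measurable_const fun t ht => ?_
          refine (lintegral_mono' Measure.restrict_le_self le_rfl).trans ?_
          refine le_trans (le_of_eq ?_)
            (lintegral_comp_add_smul hg (t • z) (r := 1 - t) (by linarith [ht.2]))
          congr with y
          congr 1
          module
      _ ≤ 2 ^ d * ∫⁻ x, g x := by
          rw [setLIntegral_const]
          exact mul_le_of_le_one_right' (hvol _ _ (by norm_num))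
  calc ∫⁻ y in A, ∫⁻ z in B, ∫⁻ t in Ioc (0 : ℝ) 1, g (y + t • (z - y))
      ≤ ∫⁻ y in A, ∫⁻ z in B, ((∫⁻ t in Ioc (0 : ℝ) (1 / 2), g (y + t • (z - y)))
        + ∫⁻ t in Ioc (1 / 2 : ℝ) 1, g (y + t • (z - y))) :=
        lintegral_mono fun y => lintegral_mono fun z => hsplit y z
    _ = (∫⁻ y in A, ∫⁻ z in B, ∫⁻ t in Ioc (0 : ℝ) (1 / 2), g (y + t • (z - y)))
        + ∫⁻ y in A, ∫⁻ z in B, ∫⁻ t in Ioc (1 / 2 : ℝ) 1, g (y + t • (z - y)) := by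
        rw [← lintegral_add_left]
        · congr with y
          rw [lintegral_add_left]
          exact (hI _).comp measurable_prodMk_left
        · exact (hI _).lintegral_prod_right'
    _ ≤ (∫⁻ _ in B, 2 ^ d * ∫⁻ x, g x) + ∫⁻ _ in A, 2 ^ d * ∫⁻ x, g x := by
        refine add_le_add ?_ (lintegral_mono hfar)
        rw [lintegral_lintegral_swap
          (f := fun y z => ∫⁻ t in Ioc (0 : ℝ) (1 / 2), g (y + t • (z - y))) (hI _).aemeasurable]
        exact lintegral_mono hnear
    _ = 2 ^ d * (volume A + volume B) * ∫⁻ x, g x := by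
        rw [setLIntegral_const, setLIntegral_const]; ring

/-! ### Mollification -/

theorem inner_gradient_eq_fderiv (φ : E d → ℝ) (x v : E d) :
    inner ℝ (gradient φ x) v = fderiv ℝ φ x v := by
  simp [gradient]

theorem inner_eq_sum_mul (x v : E d) : inner ℝ x v = ∑ i, v i * x i := by
  simp [PiLp.inner_apply]

theorem IsTest.continuous_gradient {φ : E d → ℝ} (hφ : IsTest Ω φ) : Continuous (gradient φ) := by
  have := hφ.1.continuous_fderiv (by norm_num)
  unfold gradient
  fun_prop

theorem IsTest.hasCompactSupport_gradient {φ : E d → ℝ} (hφ : IsTest Ω φ) :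
    HasCompactSupport (gradient φ) := by
  refine (hφ.2.1.fderiv (𝕜 := ℝ)).comp_left (g := (InnerProductSpace.toDual ℝ (E d)).symm) ?_
  simp

theorem locallyIntegrable_Lp {F : Type*} [NormedAddCommGroup F] (g : Lp F 2 (volume.restrict Ω)) :
    LocallyIntegrable g (volume.restrict Ω) :=
  (Lp.memLp g).locallyIntegrable (by norm_num)

/-- The weak gradient tested in an arbitrary direction `v`, not just along the coordinates. -/
theorem IsWeakGrad.integral_mul_inner {p : L2 Ω} {G : L2Vec Ω} (h : IsWeakGrad Ω p G)
    {φ : E d → ℝ} (hφ : IsTest Ω φ) (v : E d) :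
    ∫ x in Ω, p x * inner ℝ (gradient φ x) v = -∫ x in Ω, inner ℝ (G x) v * φ x := by
  have hp : ∀ i, Integrable (fun x => p x * gradient φ x i) (volume.restrict Ω) := fun i => by
    have := (locallyIntegrable_Lp p).integrable_smul_left_of_hasCompactSupport
      (g := fun x => gradient φ x i) (by have := hφ.continuous_gradient; fun_prop)
      (hφ.hasCompactSupport_gradient.comp_left (g := fun y : E d => y i) rfl)
    simpa [mul_comm] using this
  have hG : ∀ i, Integrable (fun x => G x i * φ x) (volume.restrict Ω) := fun i => by
    have := (locallyIntegrable_Lp G).integrable_smul_left_of_hasCompactSupport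
      hφ.1.continuous hφ.2.1
    have := (EuclideanSpace.proj i : E d →L[ℝ] ℝ).integrable_comp this
    simpa [mul_comm] using this
  simp_rw [inner_eq_sum_mul, Finset.mul_sum, Finset.sum_mul]
  rw [integral_finsetSum, integral_finsetSum, ← Finset.sum_neg_distrib]
  · refine Finset.sum_congr rfl fun i _ => ?_
    calc ∫ x in Ω, p x * (v i * gradient φ x i) = v i * ∫ x in Ω, p x * gradient φ x i := by
          rw [← integral_const_mul]; congr with x; ring
      _ = -∫ x in Ω, v i * G x i * φ x := by
          rw [h φ hφ i, mul_neg, ← integral_const_mul]; congr with x; ring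
  · intro i _
    simpa [mul_assoc] using (hG i).const_mul (v i)
  · intro i _
    simpa [mul_left_comm] using (hp i).const_mul (v i)

/-- The mollification `φ ∗ g` of `g`, where `φ` is scaled to have integral one. -/
noncomputable def mollify (φ : ContDiffBump (0 : E d)) (g : E d → ℝ) (x : E d) : ℝ :=
  ∫ t, g t * φ.normed volume (x - t)

theorem mollify_eq_convolution (φ : ContDiffBump (0 : E d)) (g : E d → ℝ) :
    mollify φ g = g ⋆[ContinuousLinearMap.lsmul ℝ ℝ, volume] φ.normed volume := by
  ext x
  simp [mollify, convolution_def]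

theorem contDiff_mollify (φ : ContDiffBump (0 : E d)) {g : E d → ℝ}
    (hg : LocallyIntegrable g) : ContDiff ℝ 1 (mollify φ g) := by
  rw [mollify_eq_convolution]
  exact φ.hasCompactSupport_normed.contDiff_convolution_right _ hg φ.contDiff_normed

theorem fderiv_mollify (φ : ContDiffBump (0 : E d)) {g : E d → ℝ} (hg : LocallyIntegrable g)
    (x v : E d) :
    fderiv ℝ (mollify φ g) x v = ∫ t, g t * fderiv ℝ (φ.normed volume) (x - t) v := by
  have h1 : ContDiff ℝ 1 (φ.normed (volume : Measure (E d))) := φ.contDiff_normed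
  rw [mollify_eq_convolution,
    (φ.hasCompactSupport_normed.hasFDerivAt_convolution_right _ hg h1 x).fderiv,
    convolution_precompR_apply _ hg (φ.hasCompactSupport_normed.fderiv (𝕜 := ℝ))
      (h1.continuous_fderiv (by norm_num))]
  simp [convolution_def]

theorem isTest_normed_sub (φ : ContDiffBump (0 : E d)) {x : E d}
    (hx : Metric.closedBall x φ.rOut ⊆ Ω) : IsTest Ω fun t => φ.normed volume (x - t) := by
  have hs : tsupport (fun t => φ.normed volume (x - t)) ⊆ Metric.closedBall x φ.rOut := by
    refine closure_minimal (fun t ht => ?_) Metric.isClosed_closedBall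
    have : x - t ∈ Function.support (φ.normed volume) := ht
    rw [φ.support_normed_eq, mem_ball_zero_iff] at this
    rw [mem_closedBall_iff_norm']
    exact this.le
  refine ⟨?_, ?_, hs.trans hx⟩
  · have : ContDiff ℝ ∞ (φ.normed (volume : Measure (E d))) := φ.contDiff_normed
    fun_prop
  · exact (isCompact_closedBall x φ.rOut).of_isClosed_subset (isClosed_tsupport _) hs

/-- Where the support of the mollifier fits into `Ω`, the gradient of the mollification is the
mollification of the weak gradient. -/
theorem fderiv_mollify_eq (hΩ : MeasurableSet Ω) {p : L2 Ω} {G : L2Vec Ω} (h : IsWeakGrad Ω p G)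
    (φ : ContDiffBump (0 : E d)) {x : E d} (hx : Metric.closedBall x φ.rOut ⊆ Ω)
    (hp : LocallyIntegrable (Ω.indicator p)) (v : E d) :
    fderiv ℝ (mollify φ (Ω.indicator p)) x v
      = ∫ t in Ω, inner ℝ (G t) v * φ.normed volume (x - t) := by
  have h1 : ContDiff ℝ 1 (φ.normed (volume : Measure (E d))) := φ.contDiff_normed
  have hgr : ∀ t, inner ℝ (gradient (fun t => φ.normed volume (x - t)) t) v
      = -fderiv ℝ (φ.normed volume) (x - t) v := fun t => by
    have h3 : HasFDerivAt (fun t => φ.normed volume (x - t)) _ t :=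
      ((h1.differentiable (by norm_num)) (x - t)).hasFDerivAt.comp t
        ((hasFDerivAt_id t).const_sub x)
    rw [inner_gradient_eq_fderiv, h3.fderiv]
    simp
  have h2 := h.integral_mul_inner (isTest_normed_sub φ hx) v
  rw [fderiv_mollify φ hp, ← neg_eq_iff_eq_neg.2 h2, ← integral_neg, ← integral_indicator hΩ]
  congr with t
  by_cases ht : t ∈ Ω <;> simp [ht, hgr]

/-- The total mass of the mollifier is one. -/
theorem lintegral_normed_sub (φ : ContDiffBump (0 : E d)) (x : E d) :
    ∫⁻ t, ENNReal.ofReal (φ.normed volume (x - t)) = 1 := by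
  rw [lintegral_sub_left_eq_self (fun t => ENNReal.ofReal (φ.normed volume t)),
    ← ofReal_integral_eq_lintegral_ofReal φ.integrable_normed (.of_forall φ.nonneg_normed),
    φ.integral_normed, ENNReal.ofReal_one]

/-- Jensen's inequality, for the probability density `t ↦ φ (x - t)`. -/
theorem sq_lintegral_normed_le (φ : ContDiffBump (0 : E d)) {g : E d → ℝ≥0∞} (hg : Measurable g)
    (x : E d) : (∫⁻ t, ENNReal.ofReal (φ.normed volume (x - t)) * g t) ^ 2
      ≤ ∫⁻ t, ENNReal.ofReal (φ.normed volume (x - t)) * g t ^ 2 := by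
  have hm : Measurable fun t => ENNReal.ofReal (φ.normed volume (x - t)) := by
    have := φ.continuous_normed (μ := volume)
    fun_prop
  have : IsProbabilityMeasure
      (volume.withDensity fun t => ENNReal.ofReal (φ.normed volume (x - t))) :=
    ⟨by rw [withDensity_apply _ .univ, setLIntegral_univ, lintegral_normed_sub]⟩
  have h := sq_lintegral_le
    (volume.withDensity fun t => ENNReal.ofReal (φ.normed volume (x - t))) hg.aemeasurable
  rwa [lintegral_withDensity_eq_lintegral_mul _ hm hg,
    lintegral_withDensity_eq_lintegral_mul _ hm (hg.pow_const 2)] at h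

/-- The mollification `φ ∗ g` of a function `g` with values in `[0, ∞]`. -/
noncomputable def mollifyENN (φ : ContDiffBump (0 : E d)) (g : E d → ℝ≥0∞) (x : E d) : ℝ≥0∞ :=
  ∫⁻ t, ENNReal.ofReal (φ.normed volume (x - t)) * g t

theorem measurable_mollifyENN (φ : ContDiffBump (0 : E d)) {g : E d → ℝ≥0∞} (hg : Measurable g) :
    Measurable (mollifyENN φ g) := by
  have := φ.continuous_normed (μ := volume)
  exact Measurable.lintegral_prod_right' (f := fun q : E d × E d =>
    ENNReal.ofReal (φ.normed volume (q.1 - q.2)) * g q.2) (by fun_prop)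

theorem lintegral_mollifyENN (φ : ContDiffBump (0 : E d)) {g : E d → ℝ≥0∞} (hg : Measurable g) :
    ∫⁻ x, mollifyENN φ g x = ∫⁻ x, g x := by
  have hc := φ.continuous_normed (μ := volume)
  unfold mollifyENN
  rw [lintegral_lintegral_swap (by fun_prop)]
  congr with t
  rw [lintegral_mul_const _ (by fun_prop),
    lintegral_sub_right_eq_self (fun t => ENNReal.ofReal (φ.normed volume t)),
    ← ofReal_integral_eq_lintegral_ofReal φ.integrable_normed (.of_forall φ.nonneg_normed),
    φ.integral_normed, ENNReal.ofReal_one, one_mul]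

/-- `|∇(φ ∗ p)|² ≤ φ ∗ |∇p|²` where the support of the mollifier fits into `Ω`. -/
theorem enorm_fderiv_mollify_sq_le (hΩ : MeasurableSet Ω) {p : L2 Ω} {G : L2Vec Ω}
    (h : IsWeakGrad Ω p G) (φ : ContDiffBump (0 : E d)) {x : E d}
    (hx : Metric.closedBall x φ.rOut ⊆ Ω) (hp : LocallyIntegrable (Ω.indicator p)) (v : E d) :
    ‖fderiv ℝ (mollify φ (Ω.indicator p)) x v‖ₑ ^ 2
      ≤ ‖v‖ₑ ^ 2 * mollifyENN φ (Ω.indicator fun t => ‖G t‖ₑ ^ 2) x := by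
  have hG : Measurable fun t => ‖G t‖ₑ := (Lp.stronglyMeasurable G).measurable.enorm
  have hsq : (Ω.indicator fun t => ‖G t‖ₑ ^ 2) = fun t => Ω.indicator (fun t => ‖G t‖ₑ) t ^ 2 := by
    ext t
    by_cases ht : t ∈ Ω <;> simp [ht]
  rw [fderiv_mollify_eq hΩ h φ hx hp]
  calc ‖∫ t in Ω, inner ℝ (G t) v * φ.normed volume (x - t)‖ₑ ^ 2
      ≤ (‖v‖ₑ * ∫⁻ t, ENNReal.ofReal (φ.normed volume (x - t))
          * Ω.indicator (fun t => ‖G t‖ₑ) t) ^ 2 := by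
        gcongr
        refine (enorm_integral_le_lintegral_enorm _).trans ?_
        rw [← lintegral_const_mul' _ _ enorm_ne_top, ← lintegral_indicator hΩ]
        refine lintegral_mono fun t => ?_
        by_cases ht : t ∈ Ω
        · simp only [ht, indicator_of_mem, enorm_mul]
          rw [Real.enorm_eq_ofReal (φ.nonneg_normed _), mul_comm, mul_left_comm]
          gcongr
          rw [mul_comm, ← ofReal_norm, ← ofReal_norm, ← ofReal_norm,
            ← ENNReal.ofReal_mul (norm_nonneg _)]
          exact ENNReal.ofReal_le_ofReal (norm_inner_le_norm _ _)
        · simp [ht]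
    _ ≤ ‖v‖ₑ ^ 2 * mollifyENN φ (Ω.indicator fun t => ‖G t‖ₑ ^ 2) x := by
        rw [mul_pow, hsq]
        gcongr
        exact sq_lintegral_normed_le φ (hG.indicator hΩ) x

theorem enorm_sub_sq_le_lintegral_fderiv {f : E d → ℝ} (hf : ContDiff ℝ 1 f) (y z : E d) :
    ‖f z - f y‖ₑ ^ 2
      ≤ ∫⁻ t in Ioc (0 : ℝ) 1, ‖fderiv ℝ f (y + t • (z - y)) (z - y)‖ₑ ^ 2 := by
  have hc : Continuous fun t : ℝ => fderiv ℝ f (y + t • (z - y)) (z - y) := by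
    have := hf.continuous_fderiv (by norm_num)
    fun_prop
  have hd : ∀ t ∈ uIcc (0 : ℝ) 1, HasDerivAt (fun t : ℝ => f (y + t • (z - y)))
      (fderiv ℝ f (y + t • (z - y)) (z - y)) t := fun t _ => by
    refine ((hf.differentiable (by norm_num)) _).hasFDerivAt.comp_hasDerivAt t ?_
    simpa using ((hasDerivAt_id t).smul_const (z - y)).const_add y
  have h := intervalIntegral.integral_eq_sub_of_hasDerivAt hd (hc.intervalIntegrable _ _)
  have hp : IsProbabilityMeasure (volume.restrict (Ioc (0 : ℝ) 1)) := ⟨by simp⟩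
  simp only [one_smul, zero_smul, add_sub_cancel, add_zero] at h
  rw [← h, intervalIntegral.integral_of_le zero_le_one]
  calc _ ≤ (∫⁻ t in Ioc (0 : ℝ) 1, ‖fderiv ℝ f (y + t • (z - y)) (z - y)‖ₑ) ^ 2 := by
        gcongr
        exact enorm_integral_le_lintegral_enorm _
    _ ≤ _ := sq_lintegral_le _ hc.enorm.aemeasurable

theorem locallyIntegrable_indicator (hΩ : MeasurableSet Ω) (p : L2 Ω) :
    LocallyIntegrable (Ω.indicator p) :=
  ((memLp_indicator_iff_restrict hΩ).2 (Lp.memLp p)).locallyIntegrable (by norm_num)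

theorem enorm_sub_mollify_sq_le (hΩ : MeasurableSet Ω) {p : L2 Ω} {G : L2Vec Ω}
    (h : IsWeakGrad Ω p G) (φ : ContDiffBump (0 : E d)) {y z : E d}
    (hyz : ∀ x ∈ segment ℝ y z, Metric.closedBall x φ.rOut ⊆ Ω) :
    ‖mollify φ (Ω.indicator p) z - mollify φ (Ω.indicator p) y‖ₑ ^ 2
      ≤ ‖z - y‖ₑ ^ 2 * ∫⁻ t in Ioc (0 : ℝ) 1,
          mollifyENN φ (Ω.indicator fun t => ‖G t‖ₑ ^ 2) (y + t • (z - y)) := by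
  have hp := locallyIntegrable_indicator hΩ p
  refine (enorm_sub_sq_le_lintegral_fderiv (contDiff_mollify φ hp) y z).trans ?_
  rw [← lintegral_const_mul' _ _ (by simp)]
  refine setLIntegral_mono' measurableSet_Ioc fun t ht => ?_
  refine enorm_fderiv_mollify_sq_le hΩ h φ (hyz _ ?_) hp _
  rw [segment_eq_image']
  exact ⟨t, ⟨ht.1.le, ht.2⟩, rfl⟩

/-- Mollifiers whose support shrinks to the origin. -/
noncomputable def bump (d n : ℕ) : ContDiffBump (0 : E d) :=
  ⟨1 / ((n : ℝ) + 1), 2 * (1 / ((n : ℝ) + 1)), by positivity, by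
    have : 0 < 1 / ((n : ℝ) + 1) := by positivity
    linarith⟩

theorem tendsto_rOut_bump (d : ℕ) : Tendsto (fun n => (bump d n).rOut) atTop (𝓝 0) := by
  simpa [bump] using (tendsto_one_div_add_atTop_nhds_zero_nat (𝕜 := ℝ)).const_mul 2

theorem ae_tendsto_mollify {g : E d → ℝ} (hg : LocallyIntegrable g) :
    ∀ᵐ x, Tendsto (fun n => mollify (bump d n) g x) atTop (𝓝 (g x)) := by
  filter_upwards [ContDiffBump.ae_convolution_tendsto_right_of_locallyIntegrable (K := 2)
    (tendsto_rOut_bump d) (.of_forall fun n => le_rfl) hg] with x hx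
  refine hx.congr fun n => ?_
  rw [convolution_lsmul_swap]
  simp [mollify, mul_comm]

/-! ### The Poincaré inequality for pairs of points -/

/-- `PairPoincare Ω A B` is the inequality `∫_A ∫_B |p(y) - p(z)|² dz dy ≤ C ∫_Ω |∇p|²` for all
`p ∈ H¹(Ω)`, with a constant `C` that does not depend on `p`. -/
def PairPoincare (Ω A B : Set (E d)) : Prop :=
  ∃ C : ℝ≥0, ∀ (p : L2 Ω) (G : L2Vec Ω), IsWeakGrad Ω p G →
    ∫⁻ y in A, ∫⁻ z in B, ‖p y - p z‖ₑ ^ 2 ≤ C * ∫⁻ x in Ω, ‖G x‖ₑ ^ 2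

/-- If all segments from points of `A` to points of `B` run inside `Ω`, then the difference
`p(y) - p(z)` is controlled by the integral of the gradient along the segment. This is applied to
mollifications of `p`: on each single segment the mollified gradient is eventually the gradient of
the mollification, and Fatou's lemma removes the dependence of "eventually" on the segment. -/
theorem pairPoincare_of_segment_subset (hΩ : IsOpen Ω) (hb : Bornology.IsBounded Ω)
    {A B : Set (E d)} (hA : MeasurableSet A) (hB : MeasurableSet B) (hAΩ : A ⊆ Ω) (hBΩ : B ⊆ Ω)
    (hAB : ∀ y ∈ A, ∀ z ∈ B, segment ℝ y z ⊆ Ω) : PairPoincare Ω A B := by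
  obtain ⟨D, hD⟩ := Metric.isBounded_iff.1 hb
  have hfin : ∀ S ⊆ Ω, volume S ≠ ⊤ := fun S hS => ((measure_mono hS).trans_lt hb.measure_lt_top).ne
  have hCtop : ENNReal.ofReal D ^ 2 * (2 ^ d * (volume A + volume B)) ≠ ⊤ := by
    have h1 := hfin A hAΩ
    have h2 := hfin B hBΩ
    finiteness
  refine ⟨(ENNReal.ofReal D ^ 2 * (2 ^ d * (volume A + volume B))).toNNReal, fun p G h => ?_⟩
  rw [ENNReal.coe_toNNReal hCtop]
  have hp := locallyIntegrable_indicator hΩ.measurableSet p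
  have hGm : Measurable (Ω.indicator fun t => ‖G t‖ₑ ^ 2) :=
    ((Lp.stronglyMeasurable G).measurable.enorm.pow_const 2).indicator hΩ.measurableSet
  set H : ℕ → E d → ℝ≥0∞ := fun n => mollifyENN (bump d n) (Ω.indicator fun t => ‖G t‖ₑ ^ 2)
    with hH
  have hHm : ∀ n, Measurable (H n) := fun n => measurable_mollifyENN _ hGm
  set F : ℕ → E d → E d → ℝ≥0∞ := fun n y z =>
    ENNReal.ofReal D ^ 2 * ∫⁻ t in Ioc (0 : ℝ) 1, H n (y + t • (z - y)) with hF
  have hFm : ∀ n, Measurable (Function.uncurry (F n)) := fun n => by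
    have := hHm n
    exact (Measurable.lintegral_prod_right' (f := fun q : (E d × E d) × ℝ =>
      H n (q.1.1 + q.2 • (q.1.2 - q.1.1))) (by fun_prop)).const_mul _
  have hpt : ∀ y ∈ A, ∀ z ∈ B,
      Tendsto (fun n => mollify (bump d n) (Ω.indicator p) y) atTop (𝓝 (Ω.indicator p y)) →
      Tendsto (fun n => mollify (bump d n) (Ω.indicator p) z) atTop (𝓝 (Ω.indicator p z)) →
      ‖p y - p z‖ₑ ^ 2 ≤ liminf (fun n => F n y z) atTop := by
    intro y hy z hz ty tz
    have hlim : Tendsto (fun n => ‖mollify (bump d n) (Ω.indicator p) z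
        - mollify (bump d n) (Ω.indicator p) y‖ₑ ^ 2) atTop
        (𝓝 (‖Ω.indicator p z - Ω.indicator p y‖ₑ ^ 2)) :=
      ((ENNReal.continuous_pow 2).tendsto _).comp (tz.sub ty).enorm
    rw [indicator_of_mem (hBΩ hz), indicator_of_mem (hAΩ hy)] at hlim
    rw [enorm_sub_rev, ← hlim.liminf_eq]
    refine liminf_le_liminf ?_
    obtain ⟨δ, hδ, hsub⟩ := (show IsCompact (segment ℝ y z) by
      rw [segment_eq_image']
      exact isCompact_Icc.image (by fun_prop)).exists_cthickening_subset_open hΩ (hAB y hy z hz)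
    filter_upwards [(tendsto_rOut_bump d).eventually (gt_mem_nhds hδ)] with n hn
    refine (enorm_sub_mollify_sq_le hΩ.measurableSet h (bump d n) fun x hx => ?_).trans ?_
    · exact ((Metric.closedBall_subset_closedBall hn.le).trans
        (Metric.closedBall_subset_cthickening hx δ)).trans hsub
    · simp only [hF]
      gcongr
      rw [← ofReal_norm, ← dist_eq_norm]
      exact ENNReal.ofReal_le_ofReal (hD (hBΩ hz) (hAΩ hy))
  calc ∫⁻ y in A, ∫⁻ z in B, ‖p y - p z‖ₑ ^ 2
      ≤ ∫⁻ y in A, ∫⁻ z in B, liminf (fun n => F n y z) atTop := by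
        refine lintegral_mono_ae ?_
        filter_upwards [ae_restrict_of_ae (ae_tendsto_mollify hp), ae_restrict_mem hA]
          with y ty hy
        refine lintegral_mono_ae ?_
        filter_upwards [ae_restrict_of_ae (ae_tendsto_mollify hp), ae_restrict_mem hB]
          with z tz hz
        exact hpt y hy z hz ty tz
    _ ≤ ∫⁻ y in A, liminf (fun n => ∫⁻ z in B, F n y z) atTop :=
        lintegral_mono fun y => lintegral_liminf_le fun n =>
          (hFm n).of_uncurry_left
    _ ≤ liminf (fun n => ∫⁻ y in A, ∫⁻ z in B, F n y z) atTop :=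
        lintegral_liminf_le fun n => (hFm n).lintegral_prod_right'
    _ ≤ liminf (fun _ : ℕ => ENNReal.ofReal D ^ 2 * (2 ^ d * (volume A + volume B)) *
          ∫⁻ x in Ω, ‖G x‖ₑ ^ 2) atTop := by
        refine liminf_le_liminf (.of_forall fun n => ?_)
        have e : ∫⁻ x, H n x = ∫⁻ x in Ω, ‖G x‖ₑ ^ 2 := by
          rw [hH, lintegral_mollifyENN _ hGm, lintegral_indicator hΩ.measurableSet]
        have := lintegral_segment_le (hHm n) A B
        simp only [hF]
        simp_rw [lintegral_const_mul' _ _ (show ENNReal.ofReal D ^ 2 ≠ ⊤ by finiteness)]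
        rw [mul_assoc, ← e]
        gcongr
    _ = ENNReal.ofReal D ^ 2 * (2 ^ d * (volume A + volume B)) * ∫⁻ x in Ω, ‖G x‖ₑ ^ 2 := by
        rw [liminf_const]

theorem PairPoincare.mono {A B A' B' : Set (E d)} (h : PairPoincare Ω A B) (hA : A' ⊆ A)
    (hB : B' ⊆ B) : PairPoincare Ω A' B' := by
  obtain ⟨C, hC⟩ := h
  refine ⟨C, fun p G hG => le_trans ?_ (hC p G hG)⟩
  exact (lintegral_mono_set hA).trans (lintegral_mono fun y => lintegral_mono_set hB)

theorem measurable_enorm_sub_sq (p : L2 Ω) :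
    Measurable (Function.uncurry fun y z => ‖p y - p z‖ₑ ^ 2) := by
  have := (Lp.stronglyMeasurable p).measurable
  exact Measurable.pow_const (((this.comp measurable_fst).sub (this.comp measurable_snd)).enorm) 2

theorem PairPoincare.symm {A B : Set (E d)} (h : PairPoincare Ω A B) : PairPoincare Ω B A := by
  obtain ⟨C, hC⟩ := h
  refine ⟨C, fun p G hG => le_trans (le_of_eq ?_) (hC p G hG)⟩
  rw [lintegral_lintegral_swap (measurable_enorm_sub_sq p).aemeasurable]
  simp_rw [enorm_sub_rev]

theorem PairPoincare.union {A A' B : Set (E d)} (h : PairPoincare Ω A B)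
    (h' : PairPoincare Ω A' B) : PairPoincare Ω (A ∪ A') B := by
  obtain ⟨C, hC⟩ := h
  obtain ⟨C', hC'⟩ := h'
  refine ⟨C + C', fun p G hG => ?_⟩
  rw [ENNReal.coe_add, add_mul]
  exact (lintegral_union_le _ _ _).trans (add_le_add (hC p G hG) (hC' p G hG))

theorem enorm_sub_sq_le_two_mul (a b c : ℝ) :
    ‖a - c‖ₑ ^ 2 ≤ 2 * ‖a - b‖ₑ ^ 2 + 2 * ‖b - c‖ₑ ^ 2 := by
  have h : ‖a - c‖₊ ^ 2 ≤ 2 * ‖a - b‖₊ ^ 2 + 2 * ‖b - c‖₊ ^ 2 := by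
    rw [← NNReal.coe_le_coe]
    push_cast
    simp only [Real.norm_eq_abs, sq_abs]
    nlinarith [sq_nonneg (a - b - (b - c))]
  simp only [enorm_eq_nnnorm]
  exact_mod_cast h

/-- Chaining through a set of positive measure, by averaging
`|p(y) - p(w)|² ≤ 2 |p(y) - p(z)|² + 2 |p(z) - p(w)|²` over `z ∈ B`. -/
theorem PairPoincare.trans {A B A' : Set (E d)} (h : PairPoincare Ω A B)
    (h' : PairPoincare Ω B A') (hA : volume A ≠ ⊤) (hA' : volume A' ≠ ⊤) (hB : volume B ≠ ⊤)
    (hB0 : volume B ≠ 0) : PairPoincare Ω A A' := by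
  obtain ⟨C, hC⟩ := h
  obtain ⟨C', hC'⟩ := h'.symm
  set K : ℝ≥0∞ := (volume B)⁻¹ * (2 * volume A' * C + 2 * volume A * C') with hK
  have hKtop : K ≠ ⊤ := by
    have := ENNReal.inv_ne_top.2 hB0
    finiteness
  refine ⟨K.toNNReal, fun p G hG => ?_⟩
  rw [ENNReal.coe_toNNReal hKtop]
  have hm := measurable_enorm_sub_sq p
  have hm1 : Measurable fun y => ∫⁻ z in B, ‖p y - p z‖ₑ ^ 2 := hm.lintegral_prod_right'
  have key : volume B * ∫⁻ y in A, ∫⁻ w in A', ‖p y - p w‖ₑ ^ 2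
      ≤ (2 * volume A' * C + 2 * volume A * C') * ∫⁻ x in Ω, ‖G x‖ₑ ^ 2 := by
    calc volume B * ∫⁻ y in A, ∫⁻ w in A', ‖p y - p w‖ₑ ^ 2
        = ∫⁻ y in A, ∫⁻ w in A', ∫⁻ _ in B, ‖p y - p w‖ₑ ^ 2 := by
          rw [← lintegral_const_mul' _ _ hB]
          congr with y
          rw [← lintegral_const_mul' _ _ hB]
          congr with w
          rw [setLIntegral_const, mul_comm]
      _ ≤ ∫⁻ y in A, ∫⁻ w in A', (2 * (∫⁻ z in B, ‖p y - p z‖ₑ ^ 2)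
            + 2 * ∫⁻ z in B, ‖p w - p z‖ₑ ^ 2) := by
          refine lintegral_mono fun y => lintegral_mono fun w => ?_
          refine (lintegral_mono fun z => enorm_sub_sq_le_two_mul _ (p z) _).trans ?_
          rw [lintegral_add_left (hm.of_uncurry_left.const_mul 2),
            lintegral_const_mul' _ _ (by simp), lintegral_const_mul' _ _ (by simp)]
          simp_rw [enorm_sub_rev (p w)]
          rfl
      _ = 2 * volume A' * (∫⁻ y in A, ∫⁻ z in B, ‖p y - p z‖ₑ ^ 2)
            + 2 * volume A * ∫⁻ w in A', ∫⁻ z in B, ‖p w - p z‖ₑ ^ 2 := by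
          simp_rw [lintegral_add_left measurable_const]
          rw [lintegral_add_right _ measurable_const]
          simp_rw [setLIntegral_const, lintegral_const_mul' 2 _ ENNReal.ofNat_ne_top]
          rw [lintegral_mul_const _ (hm1.const_mul 2),
            lintegral_const_mul' 2 _ ENNReal.ofNat_ne_top]
          ring
      _ ≤ 2 * volume A' * (C * ∫⁻ x in Ω, ‖G x‖ₑ ^ 2)
            + 2 * volume A * (C' * ∫⁻ x in Ω, ‖G x‖ₑ ^ 2) := by
          gcongr
          · exact hC p G hG
          · exact hC' p G hG
      _ = _ := by ring
  rw [hK, mul_assoc, ← ENNReal.div_eq_inv_mul, ENNReal.le_div_iff_mul_le (.inl hB0) (.inl hB),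
    mul_comm]
  exact key

/-! ### Local inequalities on a Lipschitz domain and their chaining -/

/-- Every point of the closure of a Lipschitz domain has a neighbourhood all of whose points in
`Ω` see a common ball. At a boundary point the ball lies above the point in the direction `ν`, at
a distance so large, compared to its radius, that the segments are steeper than the boundary. -/
theorem exists_visible_ball (hΩ : IsOpen Ω) (hL : HasLipschitzBoundary Ω) {x : E d}
    (hx : x ∈ closure Ω) : ∃ (s : ℝ) (c : E d), 0 < s ∧
      ∀ y ∈ Ω ∩ Metric.ball x s, ∀ z ∈ Metric.ball c s, segment ℝ y z ⊆ Ω := by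
  by_cases hxΩ : x ∈ Ω
  · obtain ⟨s, hs, hsub⟩ := Metric.isOpen_iff.1 hΩ x hxΩ
    exact ⟨s, x, hs, fun y hy z hz => ((convex_ball x s).segment_subset hy.2 hz).trans hsub⟩
  obtain ⟨ν, γ, K, r, hν, hγ, hr, hiff⟩ := hL x ⟨hx, by rwa [hΩ.interior_eq]⟩
  have hK : (0 : ℝ) ≤ K := K.2
  -- The vertical rise of a segment is at least `τ (r/2 - 2s)` and its horizontal displacement at
  -- most `4 τ s`, so `4 K s = r/2 - 2s` keeps it above the graph.
  set s : ℝ := (r / 2) / (4 * K + 2) with hs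
  have hs0 : 0 < s := by positivity
  have hsr : s * (4 * K + 2) = r / 2 := by rw [hs]; field_simp
  have hs4 : s ≤ r / 4 := by nlinarith
  refine ⟨s, x + (r / 2) • ν, hs0, fun y hy z hz => ?_⟩
  have hyx : ‖y - x‖ < s := mem_ball_iff_norm.1 hy.2
  have hzx : ‖z - (x + (r / 2) • ν)‖ < s := mem_ball_iff_norm.1 hz
  have hyr : y ∈ Metric.ball x r := mem_ball_iff_norm.2 (by linarith)
  have hzr : z ∈ Metric.ball x r := by
    rw [mem_ball_iff_norm]
    calc ‖z - x‖ = ‖(z - (x + (r / 2) • ν)) + (r / 2) • ν‖ := by congr 1; module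
      _ ≤ ‖z - (x + (r / 2) • ν)‖ + r / 2 := by
        refine (norm_add_le _ _).trans_eq ?_
        rw [norm_smul, hν, mul_one, Real.norm_of_nonneg (by positivity)]
      _ < r := by linarith
  intro w hw
  have hwr := (convex_ball x r).segment_subset hyr hzr hw
  rw [segment_eq_image'] at hw
  obtain ⟨τ, ⟨hτ0, hτ1⟩, rfl⟩ := hw
  rw [hiff _ hwr]
  have hyΩ := (hiff y hyr).1 hy.1
  -- `e` is the deviation of the segment from the direction `ν`
  set e : E d := z - y - (r / 2) • ν with he
  have hen : ‖e‖ ≤ 2 * s := by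
    calc ‖e‖ = ‖(z - (x + (r / 2) • ν)) - (y - x)‖ := by rw [he]; congr 1; module
      _ ≤ 2 * s := (norm_sub_le _ _).trans (by linarith)
  have hinner : |inner ℝ ν e| ≤ 2 * s := by
    refine (abs_real_inner_le_norm ν e).trans ?_
    rw [hν, one_mul]
    exact hen
  have hνν : inner ℝ ν ν = (1 : ℝ) := by rw [real_inner_self_eq_norm_sq, hν, one_pow]
  have hz : z - y = e + (r / 2) • ν := by rw [he]; module
  have hup : inner ℝ ν (y + τ • (z - y)) = inner ℝ ν y + τ * (inner ℝ ν e + r / 2) := by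
    rw [hz, inner_add_right, inner_smul_right, inner_add_right, inner_smul_right, hνν, mul_one]
  have hside : ‖(y + τ • (z - y) - inner ℝ ν (y + τ • (z - y)) • ν) - (y - inner ℝ ν y • ν)‖
      ≤ τ * (4 * s) := by
    rw [hup, hz]
    calc _ = ‖τ • (e - inner ℝ ν e • ν)‖ := by congr 1; module
      _ = τ * ‖e - inner ℝ ν e • ν‖ := by rw [norm_smul, Real.norm_of_nonneg hτ0]
      _ ≤ τ * (4 * s) := by
        gcongr
        refine (norm_sub_le _ _).trans ?_
        rw [norm_smul, hν, mul_one, Real.norm_eq_abs]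
        linarith
  have hγ' := (le_abs_self _).trans (hγ.dist_le_mul
    (y + τ • (z - y) - inner ℝ ν (y + τ • (z - y)) • ν) (y - inner ℝ ν y • ν))
  rw [dist_eq_norm] at hγ'
  have h1 : (K : ℝ) * ‖(y + τ • (z - y) - inner ℝ ν (y + τ • (z - y)) • ν)
      - (y - inner ℝ ν y • ν)‖ ≤ K * (τ * (4 * s)) := by gcongr
  have h2 : τ * (K * (4 * s)) ≤ τ * (inner ℝ ν e + r / 2) := by
    gcongr
    linarith [(abs_le.1 hinner).1]
  rw [hup]
  rw [hup] at hγ' h1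
  linarith

/-- `Ω` has positive measure near every point of its closure, so that chains can pass through
boundary points. -/
theorem volume_inter_ne_zero (hΩ : IsOpen Ω) {x : E d} (hx : x ∈ closure Ω) {U : Set (E d)}
    (hU : U ∈ 𝓝 x) : volume (U ∩ Ω) ≠ 0 := by
  have hne : (interior U ∩ Ω).Nonempty :=
    mem_closure_iff.1 hx _ isOpen_interior (mem_interior_iff_mem_nhds.2 hU)
  have h0 := ((isOpen_interior.inter hΩ).measure_pos volume hne).ne'
  exact fun h => h0 (measure_mono_null (inter_subset_inter_left _ interior_subset) h)

theorem exists_nhds_pairPoincare (hΩ : IsLipschitzDomain Ω) {x : E d} (hx : x ∈ closure Ω) :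
    ∃ U, IsOpen U ∧ x ∈ U ∧ PairPoincare Ω (U ∩ Ω) (U ∩ Ω) := by
  obtain ⟨s, c, hs, hvis⟩ := exists_visible_ball hΩ.isOpen hΩ.lipschitz hx
  obtain ⟨y, hy, hyΩ⟩ := mem_closure_iff.1 hx _ Metric.isOpen_ball (Metric.mem_ball_self hs)
  have hball : Metric.ball c s ⊆ Ω := fun z hz => hvis y ⟨hyΩ, hy⟩ z hz (right_mem_segment ℝ y z)
  have h : PairPoincare Ω (Metric.ball x s ∩ Ω) (Metric.ball c s) :=
    pairPoincare_of_segment_subset hΩ.isOpen hΩ.isBounded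
      (Metric.isOpen_ball.inter hΩ.isOpen).measurableSet Metric.isOpen_ball.measurableSet
      inter_subset_right hball fun y hy z hz => hvis y hy.symm z hz
  have hfin : volume (Metric.ball x s ∩ Ω) ≠ ⊤ :=
    ((measure_mono inter_subset_right).trans_lt hΩ.isBounded.measure_lt_top).ne
  exact ⟨Metric.ball x s, Metric.isOpen_ball, Metric.mem_ball_self hs,
    h.trans h.symm hfin hfin Metric.isBounded_ball.measure_lt_top.ne
      (Metric.measure_ball_pos volume c hs).ne'⟩

/-- The Poincaré inequality for pairs of points spreads from small neighbourhoods to `Ω`: by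
connectedness of the closure any two points have neighbourhoods that are linked by a chain, and by
compactness finitely many of them suffice. -/
theorem pairPoincare_self (hΩ : IsLipschitzDomain Ω) : PairPoincare Ω Ω Ω := by
  have hfin : ∀ U : Set (E d), volume (U ∩ Ω) ≠ ⊤ := fun U =>
    ((measure_mono inter_subset_right).trans_lt hΩ.isBounded.measure_lt_top).ne
  have hlink : ∀ x ∈ closure Ω, ∀ y ∈ closure Ω,
      ∃ U ∈ 𝓝 x, ∃ V ∈ 𝓝 y, PairPoincare Ω (U ∩ Ω) (V ∩ Ω) := by
    intro x hx y hy
    refine hΩ.isConnected.isPreconnected.closure.induction₂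
      (fun x y => ∃ U ∈ 𝓝 x, ∃ V ∈ 𝓝 y, PairPoincare Ω (U ∩ Ω) (V ∩ Ω)) ?_ ?_ ?_ hx hy
    · intro x hx
      obtain ⟨U, hU, hxU, h⟩ := exists_nhds_pairPoincare hΩ hx
      filter_upwards [mem_nhdsWithin_of_mem_nhds (hU.mem_nhds hxU)] with y hy
      exact ⟨U, hU.mem_nhds hxU, U, hU.mem_nhds hy, h⟩
    · rintro x y z - hy - ⟨U, hU, V, hV, h⟩ ⟨V', hV', W, hW, h'⟩
      refine ⟨U, hU, W, hW, PairPoincare.trans (B := (V ∩ V') ∩ Ω) (h.mono subset_rfl ?_)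
        (h'.mono ?_ subset_rfl) (hfin _) (hfin _) (hfin _)
        (volume_inter_ne_zero hΩ.isOpen hy (inter_mem hV hV'))⟩
      · exact inter_subset_inter_left _ inter_subset_left
      · exact inter_subset_inter_left _ inter_subset_right
    · rintro x y - - ⟨U, hU, V, hV, h⟩
      exact ⟨V, hV, U, hU, h.symm⟩
  have hc : IsCompact (closure Ω) := hΩ.isBounded.isCompact_closure
  have hempty : ∀ B : Set (E d), PairPoincare Ω ∅ B := fun B => ⟨0, by simp⟩
  -- Cover the second variable first: finitely many neighbourhoods of the fixed point `x` intersect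
  -- in a neighbourhood.
  have hone : ∀ x ∈ closure Ω, ∃ U ∈ 𝓝 x, PairPoincare Ω (U ∩ Ω) (closure Ω ∩ Ω) := by
    intro x hx
    refine hc.induction_on (p := fun S => ∃ U ∈ 𝓝 x, PairPoincare Ω (U ∩ Ω) (S ∩ Ω)) ?_ ?_ ?_ ?_
    · exact ⟨univ, univ_mem, by simpa using (hempty _).symm⟩
    · rintro S T hST ⟨U, hU, h⟩
      exact ⟨U, hU, h.mono subset_rfl (inter_subset_inter_left _ hST)⟩
    · rintro S T ⟨U, hU, h⟩ ⟨V, hV, h'⟩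
      refine ⟨U ∩ V, inter_mem hU hV, ?_⟩
      rw [union_inter_distrib_right]
      exact (PairPoincare.union
        (h.mono (inter_subset_inter_left _ inter_subset_left) subset_rfl).symm
        (h'.mono (inter_subset_inter_left _ inter_subset_right) subset_rfl).symm).symm
    · intro y hy
      obtain ⟨U, hU, V, hV, h⟩ := hlink x hx y hy
      exact ⟨V, mem_nhdsWithin_of_mem_nhds hV, U, hU, h⟩
  have hall : PairPoincare Ω (closure Ω ∩ Ω) (closure Ω ∩ Ω) := by
    refine hc.induction_on (p := fun S => PairPoincare Ω (S ∩ Ω) (closure Ω ∩ Ω)) ?_ ?_ ?_ ?_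
    · simpa using hempty _
    · exact fun S T hST h => h.mono (inter_subset_inter_left _ hST) subset_rfl
    · intro S T h h'
      rw [union_inter_distrib_right]
      exact h.union h'
    · intro x hx
      obtain ⟨U, hU, h⟩ := hone x hx
      exact ⟨U, mem_nhdsWithin_of_mem_nhds hU, h⟩
  rwa [inter_eq_self_of_subset_right subset_closure] at hall

/-! ### The Poincaré inequality in `L²` -/

theorem L2_inner_eq (f g : L2 Ω) : inner ℝ f g = ∫ x in Ω, f x * g x := by
  rw [L2.inner_def]
  congr with x
  simp [mul_comm]

theorem L2_norm_sq_eq {F : Type*} [NormedAddCommGroup F] [InnerProductSpace ℝ F]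
    (f : Lp F 2 (volume.restrict Ω)) : ‖f‖ ^ 2 = ∫ x in Ω, ‖f x‖ ^ 2 := by
  rw [← real_inner_self_eq_norm_sq, L2.inner_def]
  simp_rw [real_inner_self_eq_norm_sq]

theorem lintegral_enorm_sq_eq {F : Type*} [NormedAddCommGroup F] [InnerProductSpace ℝ F]
    (f : Lp F 2 (volume.restrict Ω)) : ∫⁻ x in Ω, ‖f x‖ₑ ^ 2 = ENNReal.ofReal (‖f‖ ^ 2) := by
  rw [L2_norm_sq_eq, ofReal_integral_eq_lintegral_ofReal
    (MemLp.integrable_norm_pow (p := 2) (by simpa using Lp.memLp f) two_ne_zero)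
    (.of_forall fun x => by positivity)]
  simp_rw [ENNReal.ofReal_pow (norm_nonneg _), ofReal_norm]

/-- `∫_Ω ∫_Ω |p(y) - p(z)|² dz dy = 2 (|Ω| ‖p‖² - (∫_Ω p)²)`. -/
theorem lintegral_lintegral_enorm_sub_sq [IsFiniteMeasure (volume.restrict Ω)] (p : L2 Ω) :
    ∫⁻ y in Ω, ∫⁻ z in Ω, ‖p y - p z‖ₑ ^ 2
      = ENNReal.ofReal (2 * (volume.real Ω * ‖p‖ ^ 2 - (∫ x in Ω, p x) ^ 2)) := by
  have hp1 : Integrable p (volume.restrict Ω) := (Lp.memLp p).integrable (by norm_num)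
  have hp2 : Integrable (fun x => p x ^ 2) (volume.restrict Ω) := (Lp.memLp p).integrable_sq
  have hn : ‖p‖ ^ 2 = ∫ x in Ω, p x ^ 2 := by simp [L2_norm_sq_eq]
  set I := ∫ x in Ω, p x with hI
  set N := ∫ x in Ω, p x ^ 2 with hN
  have e : ∀ y z : ℝ, ‖y - z‖ₑ ^ 2 = ENNReal.ofReal ((y - z) ^ 2) := fun y z => by
    rw [← ofReal_norm, ← ENNReal.ofReal_pow (norm_nonneg _), Real.norm_eq_abs, sq_abs]
  have ez : ∀ y : ℝ, ∫ z in Ω, (y - p z) ^ 2 = volume.real Ω * y ^ 2 - 2 * y * I + N := fun y => by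
    have : (fun z => (y - p z) ^ 2) = fun z => y ^ 2 - 2 * y * p z + p z ^ 2 := by
      ext z; ring
    have hi1 : Integrable (fun z => y ^ 2 - 2 * y * p z) (volume.restrict Ω) :=
      (integrable_const _).sub (hp1.const_mul _)
    rw [this, integral_add hi1 hp2,
      integral_sub (integrable_const _) (hp1.const_mul _), integral_const_mul]
    simp [hI, hN]
  have hi : ∀ y : ℝ, Integrable (fun z => (y - p z) ^ 2) (volume.restrict Ω) := fun y =>
    ((memLp_const y).sub (Lp.memLp p)).integrable_sq
  have hint1 : Integrable (fun y => volume.real Ω * p y ^ 2 - 2 * p y * I) (volume.restrict Ω) :=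
    (hp2.const_mul _).sub ((hp1.const_mul 2).mul_const I)
  have hint : Integrable (fun y => volume.real Ω * p y ^ 2 - 2 * p y * I + N)
      (volume.restrict Ω) := hint1.add (integrable_const _)
  have e1 : ∀ y : ℝ, ∫⁻ z in Ω, ‖y - p z‖ₑ ^ 2
      = ENNReal.ofReal (volume.real Ω * y ^ 2 - 2 * y * I + N) := fun y => by
    simp_rw [e]
    rw [← ofReal_integral_eq_lintegral_ofReal (hi y) (.of_forall fun z => sq_nonneg _), ez]
  simp_rw [e1]
  rw [← ofReal_integral_eq_lintegral_ofReal hint (.of_forall fun y =>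
      (integral_nonneg fun z => sq_nonneg _).trans_eq (ez (p y))),
    integral_add hint1 (integrable_const _),
    integral_sub (hp2.const_mul _) ((hp1.const_mul 2).mul_const I), integral_const_mul,
    integral_mul_const, integral_const_mul, ← hI, ← hN, hn]
  congr 1
  simp
  ring

theorem IsLipschitzDomain.isFiniteMeasure (hΩ : IsLipschitzDomain Ω) :
    IsFiniteMeasure (volume.restrict Ω) :=
  ⟨by rw [Measure.restrict_apply_univ]; exact hΩ.isBounded.measure_lt_top⟩

theorem IsLipschitzDomain.volume_real_pos (hΩ : IsLipschitzDomain Ω) : 0 < volume.real Ω :=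
  ENNReal.toReal_pos (hΩ.isOpen.measure_pos volume hΩ.isConnected.nonempty).ne'
    hΩ.isBounded.measure_lt_top.ne

/-- The Poincaré inequality on a Lipschitz domain. -/
theorem exists_poincare (hΩ : IsLipschitzDomain Ω) : ∃ C : ℝ, 0 ≤ C ∧
    ∀ (p : L2 Ω) (G : L2Vec Ω), IsWeakGrad Ω p G →
      ‖p‖ ^ 2 ≤ C * ‖G‖ ^ 2 + (volume.real Ω)⁻¹ * (∫ x in Ω, p x) ^ 2 := by
  have := hΩ.isFiniteMeasure
  have hm := hΩ.volume_real_pos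
  obtain ⟨C, hC⟩ := pairPoincare_self hΩ
  refine ⟨(2 * volume.real Ω)⁻¹ * C, by positivity, fun p G h => ?_⟩
  have h1 := hC p G h
  rw [lintegral_lintegral_enorm_sub_sq, lintegral_enorm_sq_eq, ← ENNReal.ofReal_coe_nnreal,
    ← ENNReal.ofReal_mul C.coe_nonneg, ENNReal.ofReal_le_ofReal_iff (by positivity)] at h1
  have h2 : ‖p‖ ^ 2 = (2 * volume.real Ω)⁻¹ *
      (2 * (volume.real Ω * ‖p‖ ^ 2 - (∫ x in Ω, p x) ^ 2))
        + (volume.real Ω)⁻¹ * (∫ x in Ω, p x) ^ 2 := by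
    field_simp
    ring
  rw [h2, mul_assoc]
  gcongr

/-! ### Test functions and Green's formula -/

theorem weakDiv_eq (hΩ : IsOpen Ω) {u : L2Vec Ω} {g : L2 Ω} (h : IsWeakDiv Ω u g) :
    weakDiv Ω u = g := by
  have he : ∃ g, IsWeakDiv Ω u g := ⟨g, h⟩
  rw [weakDiv, dif_pos he]
  exact he.choose_spec.unique hΩ h

theorem gradient_apply (φ : E d → ℝ) (x : E d) (i : Fin d) :
    gradient φ x i = fderiv ℝ φ x (EuclideanSpace.single i 1) := by
  rw [← inner_gradient_eq_fderiv, EuclideanSpace.inner_single_right]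
  simp

theorem IsTest.memLp {φ : E d → ℝ} (hφ : IsTest Ω φ) : MemLp φ 2 (volume.restrict Ω) :=
  (hφ.1.continuous.memLp_of_hasCompactSupport hφ.2.1).restrict Ω

theorem IsTest.memLp_gradient {φ : E d → ℝ} (hφ : IsTest Ω φ) :
    MemLp (gradient φ) 2 (volume.restrict Ω) :=
  (hφ.continuous_gradient.memLp_of_hasCompactSupport hφ.hasCompactSupport_gradient).restrict Ω

/-- The partial derivative `∂ᵢφ` of a test function, as an element of `L²(Ω)`. -/
noncomputable def IsTest.deriv {φ : E d → ℝ} (hφ : IsTest Ω φ) (i : Fin d) : L2 Ω :=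
  (hφ.memLp_gradient.eval_piLp i).toLp

theorem IsTest.memLp_field {φ : E d → ℝ} (hφ : IsTest Ω φ) (i : Fin d) :
    MemLp (fun x => φ x • EuclideanSpace.single i (1 : ℝ)) 2 (volume.restrict Ω) :=
  ((hφ.1.continuous.smul continuous_const).memLp_of_hasCompactSupport
    hφ.2.1.smul_right).restrict Ω

/-- The vector field `φ eᵢ`, for a test function `φ`, as an element of `L²(Ω; ℝ^d)`. -/
noncomputable def IsTest.field {φ : E d → ℝ} (hφ : IsTest Ω φ) (i : Fin d) : L2Vec Ω :=
  (hφ.memLp_field i).toLp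

theorem IsTest.inner_deriv {φ : E d → ℝ} (hφ : IsTest Ω φ) (i : Fin d) (q : L2 Ω) :
    inner ℝ (hφ.deriv i) q = ∫ x in Ω, q x * gradient φ x i := by
  rw [L2_inner_eq]
  refine integral_congr_ae ?_
  filter_upwards [(hφ.memLp_gradient.eval_piLp i).coeFn_toLp] with x hx
  rw [IsTest.deriv, hx, mul_comm]

theorem IsTest.inner_field {φ : E d → ℝ} (hφ : IsTest Ω φ) (i : Fin d) (H : L2Vec Ω) :
    inner ℝ (hφ.field i) H = ∫ x in Ω, H x i * φ x := by
  rw [L2.inner_def]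
  refine integral_congr_ae ?_
  filter_upwards [(hφ.memLp_field i).coeFn_toLp] with x hx
  rw [IsTest.field, hx, inner_smul_left, EuclideanSpace.inner_single_left]
  simp [mul_comm]

theorem isWeakGrad_iff_inner {p : L2 Ω} {G : L2Vec Ω} : IsWeakGrad Ω p G ↔
    ∀ (φ : E d → ℝ) (hφ : IsTest Ω φ) (i : Fin d),
      inner ℝ (hφ.deriv i) p + inner ℝ (hφ.field i) G = 0 := by
  simp_rw [IsTest.inner_deriv, IsTest.inner_field, ← eq_neg_iff_add_eq_zero]
  rfl

/-- A test function, as an element of `L²(Ω)`. -/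
noncomputable def IsTest.toL2 {φ : E d → ℝ} (hφ : IsTest Ω φ) : L2 Ω := hφ.memLp.toLp

/-- The gradient of a test function, as an element of `L²(Ω; ℝ^d)`. -/
noncomputable def IsTest.grad {φ : E d → ℝ} (hφ : IsTest Ω φ) : L2Vec Ω := hφ.memLp_gradient.toLp

/-- Integration by parts for two test functions. -/
theorem IsTest.setIntegral_mul_gradient {φ ψ : E d → ℝ} (hφ : IsTest Ω φ) (hψ : IsTest Ω ψ)
    (i : Fin d) : ∫ x in Ω, φ x * gradient ψ x i = -∫ x in Ω, gradient φ x i * ψ x := by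
  have hz : ∀ x, x ∉ Ω → φ x = 0 := fun x hx =>
    image_eq_zero_of_notMem_tsupport fun h => hx (hφ.2.2 h)
  have hz' : ∀ x, x ∉ Ω → ψ x = 0 := fun x hx =>
    image_eq_zero_of_notMem_tsupport fun h => hx (hψ.2.2 h)
  rw [setIntegral_eq_integral_of_forall_compl_eq_zero fun x hx => by simp [hz x hx],
    setIntegral_eq_integral_of_forall_compl_eq_zero fun x hx => by simp [hz' x hx]]
  simp_rw [gradient_apply]
  have cφ := hφ.1.continuous_fderiv (by norm_num)
  have cψ := hψ.1.continuous_fderiv (by norm_num)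
  have cφ0 := hφ.1.continuous
  have cψ0 := hψ.1.continuous
  refine integral_mul_fderiv_eq_neg_fderiv_mul_of_integrable ?_ ?_ ?_
    (fun x _ => hφ.1.differentiable (by norm_num) x)
    (fun x _ => hψ.1.differentiable (by norm_num) x)
  · exact Continuous.integrable_of_hasCompactSupport (by fun_prop) hψ.2.1.mul_left
  · exact Continuous.integrable_of_hasCompactSupport (by fun_prop) hφ.2.1.mul_right
  · exact Continuous.integrable_of_hasCompactSupport (by fun_prop) hφ.2.1.mul_right

theorem IsTest.isWeakGrad {φ : E d → ℝ} (hφ : IsTest Ω φ) : IsWeakGrad Ω hφ.toL2 hφ.grad := by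
  intro ψ hψ i
  calc ∫ x in Ω, hφ.toL2 x * gradient ψ x i = ∫ x in Ω, φ x * gradient ψ x i := by
        refine integral_congr_ae ?_
        filter_upwards [hφ.memLp.coeFn_toLp] with x hx
        rw [IsTest.toL2, hx]
    _ = -∫ x in Ω, gradient φ x i * ψ x := hφ.setIntegral_mul_gradient hψ i
    _ = -∫ x in Ω, hφ.grad x i * ψ x := by
        congr 1
        refine integral_congr_ae ?_
        filter_upwards [hφ.memLp_gradient.coeFn_toLp] with x hx
        rw [IsTest.grad, hx]

/-- `u ∈ H₀(div, Ω)` has divergence `g` iff Green's formula without boundary term holds for all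
functions in `H¹(Ω)`; this already contains the definition of the weak divergence, since test
functions belong to `H¹(Ω)`. -/
theorem mem_HDivZero_iff (hΩ : IsOpen Ω) {u : L2Vec Ω} {g : L2 Ω} :
    (u ∈ HDivZero Ω ∧ weakDiv Ω u = g) ↔
      ∀ (q : L2 Ω) (H : L2Vec Ω), IsWeakGrad Ω q H → inner ℝ u H + inner ℝ g q = 0 := by
  constructor
  · rintro ⟨⟨-, hu⟩, rfl⟩ q H h
    rw [L2.inner_def, L2_inner_eq]
    exact hu q H h
  · intro h
    have hdiv : IsWeakDiv Ω u g := fun φ hφ => by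
      have e := h _ _ hφ.isWeakGrad
      rw [L2.inner_def, L2_inner_eq, add_eq_zero_iff_eq_neg] at e
      convert e using 1
      · refine integral_congr_ae ?_
        filter_upwards [hφ.memLp_gradient.coeFn_toLp] with x hx
        rw [IsTest.grad, hx]
      · congr 1
        refine integral_congr_ae ?_
        filter_upwards [hφ.memLp.coeFn_toLp] with x hx
        rw [IsTest.toL2, hx]
    have hg := weakDiv_eq hΩ hdiv
    refine ⟨⟨⟨g, hdiv⟩, fun q H hq => ?_⟩, hg⟩
    have e := h q H hq
    rwa [L2.inner_def, L2_inner_eq, ← hg] at e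

/-- The fields `φ eᵢ` belong to `H₀(div, Ω)`, with divergence `∂ᵢφ`. -/
theorem IsTest.field_mem_HDivZero (hΩ : IsOpen Ω) {φ : E d → ℝ} (hφ : IsTest Ω φ) (i : Fin d) :
    hφ.field i ∈ HDivZero Ω ∧ weakDiv Ω (hφ.field i) = hφ.deriv i := by
  rw [mem_HDivZero_iff hΩ]
  intro q H h
  rw [add_comm]
  exact isWeakGrad_iff_inner.1 h φ hφ i

/-! ### The mixed system as a variational problem -/

section Reaction

variable [IsFiniteMeasure (volume.restrict Ω)]

/-- The constant function `1`, as an element of `L²(Ω)`. -/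
noncomputable def oneL2 (Ω : Set (E d)) [IsFiniteMeasure (volume.restrict Ω)] : L2 Ω :=
  Lp.const 2 (volume.restrict Ω) 1

theorem inner_oneL2 (p : L2 Ω) : inner ℝ (oneL2 Ω) p = ∫ x in Ω, p x := by
  rw [L2_inner_eq]
  refine integral_congr_ae ?_
  filter_upwards [Lp.coeFn_const 2 (volume.restrict Ω) (1 : ℝ)] with x hx
  rw [oneL2, hx, Function.const_apply, one_mul]

theorem norm_oneL2_sq : ‖oneL2 Ω‖ ^ 2 = volume.real Ω := by
  rw [← real_inner_self_eq_norm_sq, inner_oneL2]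
  calc ∫ x in Ω, oneL2 Ω x = ∫ x in Ω, (1 : ℝ) := by
        refine integral_congr_ae ?_
        filter_upwards [Lp.coeFn_const 2 (volume.restrict Ω) (1 : ℝ)] with x hx
        rw [oneL2, hx, Function.const_apply]
    _ = volume.real Ω := by simp

/-- The operator `α I + (1 - α) Π` of `L²(Ω)`, with `Π` the projection onto constants. -/
noncomputable def reaction (Ω : Set (E d)) [IsFiniteMeasure (volume.restrict Ω)] (α : ℝ) :
    L2 Ω →L[ℝ] L2 Ω :=
  α • ContinuousLinearMap.id ℝ (L2 Ω)
    + ((1 - α) * (volume.real Ω)⁻¹) • (innerSL ℝ (oneL2 Ω)).smulRight (oneL2 Ω)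

theorem reaction_apply (α : ℝ) (p : L2 Ω) :
    reaction Ω α p = α • p + ((1 - α) * ((volume.real Ω)⁻¹ * ∫ x in Ω, p x)) • oneL2 Ω := by
  simp [reaction, inner_oneL2, smul_smul, mul_assoc]

theorem inner_reaction (α : ℝ) (p q : L2 Ω) : inner ℝ (reaction Ω α p) q
    = ∫ x in Ω, (α * p x + (1 - α) * projConst Ω p x) * q x := by
  rw [L2_inner_eq]
  refine integral_congr_ae ?_
  rw [reaction_apply]
  filter_upwards [Lp.coeFn_add (α • p)
      (((1 - α) * ((volume.real Ω)⁻¹ * ∫ x in Ω, p x)) • oneL2 Ω), Lp.coeFn_smul α p,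
    Lp.coeFn_smul ((1 - α) * ((volume.real Ω)⁻¹ * ∫ x in Ω, p x)) (oneL2 Ω),
    Lp.coeFn_const 2 (volume.restrict Ω) (1 : ℝ)] with x h1 h2 h3 h4
  rw [h1, Pi.add_apply, h2, h3, Pi.smul_apply, Pi.smul_apply, oneL2, h4]
  simp [projConst, setAverage_eq]

theorem inner_reaction_self (α : ℝ) (p : L2 Ω) : inner ℝ (reaction Ω α p) p
    = α * ‖p‖ ^ 2 + (1 - α) * ((volume.real Ω)⁻¹ * (∫ x in Ω, p x) ^ 2) := by
  rw [reaction_apply, inner_add_left, inner_smul_left, inner_smul_left, inner_oneL2,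
    real_inner_self_eq_norm_sq]
  simp only [conj_trivial]
  ring

/-- `‖Π p‖² ≤ ‖p‖²`, with `‖Π p‖² = (∫_Ω p)² / |Ω|`. -/
theorem inv_volume_mul_sq_integral_le (hm : 0 < volume.real Ω) (p : L2 Ω) :
    (volume.real Ω)⁻¹ * (∫ x in Ω, p x) ^ 2 ≤ ‖p‖ ^ 2 := by
  rw [inv_mul_le_iff₀ hm, ← norm_oneL2_sq, ← inner_oneL2, ← mul_pow]
  exact sq_le_sq.2 (by
    rw [abs_mul, abs_norm, abs_norm]
    exact abs_real_inner_le_norm _ _)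

theorem le_inner_reaction_self (hm : 0 < volume.real Ω) {α : ℝ} (hα : 0 ≤ α) (p : L2 Ω) :
    (volume.real Ω)⁻¹ * (∫ x in Ω, p x) ^ 2 ≤ inner ℝ (reaction Ω α p) p := by
  rw [inner_reaction_self]
  nlinarith [mul_le_mul_of_nonneg_left (inv_volume_mul_sq_integral_le hm p) hα]

theorem norm_reaction_le (hm : 0 < volume.real Ω) {α : ℝ} (hα : 0 ≤ α) (hα1 : α ≤ 1) (p : L2 Ω) :
    ‖reaction Ω α p‖ ≤ ‖p‖ := by
  have h1 : ‖((volume.real Ω)⁻¹ * ∫ x in Ω, p x) • oneL2 Ω‖ ≤ ‖p‖ := by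
    refine (sq_le_sq₀ (norm_nonneg _) (norm_nonneg _)).1 ?_
    refine le_trans (le_of_eq ?_) (inv_volume_mul_sq_integral_le hm p)
    rw [norm_smul, mul_pow, norm_oneL2_sq, Real.norm_eq_abs, sq_abs]
    field_simp
  rw [reaction_apply, mul_smul]
  calc _ ≤ α * ‖p‖ + (1 - α) * ‖((volume.real Ω)⁻¹ * ∫ x in Ω, p x) • oneL2 Ω‖ := by
        refine (norm_add_le _ _).trans_eq ?_
        rw [norm_smul, norm_smul (1 - α), Real.norm_of_nonneg hα,
          Real.norm_of_nonneg (sub_nonneg.2 hα1)]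
    _ ≤ α * ‖p‖ + (1 - α) * ‖p‖ := by
        have := sub_nonneg.2 hα1
        gcongr
    _ = ‖p‖ := by ring

/-- The mixed system says that `∇p = -u` weakly, and that `u` has vanishing normal trace and
divergence `f - (α I + (1 - α) Π) p`. -/
theorem isSolution_iff (hΩ : IsOpen Ω) {α : ℝ} {f : L2 Ω} {u : L2Vec Ω} {p : L2 Ω} :
    IsSolution Ω α f u p ↔ IsWeakGrad Ω p (-u) ∧ u ∈ HDivZero Ω ∧
      weakDiv Ω u = f - reaction Ω α p := by
  constructor
  · intro h
    refine ⟨isWeakGrad_iff_inner.2 fun φ hφ i => ?_, h.mem, ?_⟩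
    · obtain ⟨hv, hdiv⟩ := hφ.field_mem_HDivZero hΩ i
      have e := h.first _ hv
      rw [← L2.inner_def, ← L2_inner_eq, hdiv, real_inner_comm, real_inner_comm (hφ.deriv i)] at e
      rw [inner_neg_right]
      linarith
    · refine ext_inner_right ℝ fun q => ?_
      have e := h.second q
      rw [← L2_inner_eq, ← L2_inner_eq, ← inner_reaction] at e
      rw [inner_sub_left]
      linarith
  · rintro ⟨hp, hu, hdiv⟩
    refine ⟨hu, fun v hv => ?_, fun q => ?_⟩
    · have e := (mem_HDivZero_iff hΩ).1 ⟨hv, rfl⟩ p (-u) hp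
      rw [inner_neg_right, real_inner_comm, real_inner_comm p] at e
      rw [← L2.inner_def, ← L2_inner_eq]
      linarith
    · rw [← L2_inner_eq, ← L2_inner_eq, ← inner_reaction, hdiv, inner_sub_left]
      ring

end Reaction

/-! ### Lax-Milgram on `H¹(Ω)` -/

/-- The space `H¹(Ω)`, as the closed subspace of the pairs `(p, ∇p)` in `L²(Ω) × L²(Ω; ℝ^d)`. It is
written as the orthogonal complement of the pairs `(∂ᵢφ, φ eᵢ)`. -/
noncomputable def H1 (Ω : Set (E d)) : Submodule ℝ (WithLp 2 (L2 Ω × L2Vec Ω)) :=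
  (Submodule.span ℝ {w | ∃ (φ : E d → ℝ) (hφ : IsTest Ω φ) (i : Fin d),
    w = WithLp.toLp 2 (hφ.deriv i, hφ.field i)})ᗮ

theorem mem_H1_iff {w : WithLp 2 (L2 Ω × L2Vec Ω)} : w ∈ H1 Ω ↔ IsWeakGrad Ω w.fst w.snd := by
  rw [H1, Submodule.mem_orthogonal, isWeakGrad_iff_inner]
  constructor
  · intro h φ hφ i
    have e := h _ (Submodule.subset_span ⟨φ, hφ, i, rfl⟩)
    rwa [WithLp.prod_inner_apply] at e
  · intro h v hv
    induction hv using Submodule.span_induction with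
    | mem v hv =>
      obtain ⟨φ, hφ, i, rfl⟩ := hv
      rw [WithLp.prod_inner_apply]
      exact h φ hφ i
    | zero => exact inner_zero_left _
    | add v v' _ _ h1 h2 => rw [inner_add_left, h1, h2, add_zero]
    | smul a v _ h1 => rw [inner_smul_left, h1, mul_zero]

/-- The bilinear form `∫ ∇p · ∇q + ∫ (T p) q` on `H¹(Ω)`. -/
noncomputable def h1Form (Ω : Set (E d)) (T : L2 Ω →L[ℝ] L2 Ω) : H1 Ω →L[ℝ] H1 Ω →L[ℝ] ℝ :=
  let fst : H1 Ω →L[ℝ] L2 Ω := (WithLp.fstL 2 ℝ (L2 Ω) (L2Vec Ω)).comp (H1 Ω).subtypeL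
  let snd : H1 Ω →L[ℝ] L2Vec Ω := (WithLp.sndL 2 ℝ (L2 Ω) (L2Vec Ω)).comp (H1 Ω).subtypeL
  (isBoundedBilinearMap_inner (𝕜 := ℝ)).toContinuousLinearMap.bilinearComp snd snd
    + (isBoundedBilinearMap_inner (𝕜 := ℝ)).toContinuousLinearMap.bilinearComp (T.comp fst) fst

theorem h1Form_apply (T : L2 Ω →L[ℝ] L2 Ω) (v w : H1 Ω) : h1Form Ω T v w
    = inner ℝ v.1.snd w.1.snd + inner ℝ (T v.1.fst) w.1.fst := rfl

theorem isCoercive_h1Form {T : L2 Ω →L[ℝ] L2 Ω} {C : ℝ} (hC : 0 ≤ C)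
    (hT : ∀ p G, IsWeakGrad Ω p G → ‖p‖ ^ 2 ≤ C * ‖G‖ ^ 2 + inner ℝ (T p) p)
    (hT0 : ∀ p, 0 ≤ inner ℝ (T p) p) : IsCoercive (h1Form Ω T) := by
  refine ⟨(C + 1)⁻¹, by positivity, fun v => ?_⟩
  have h := hT _ _ (mem_H1_iff.1 v.2)
  have h0 := hT0 v.1.fst
  have hn : ‖v‖ ^ 2 = ‖v.1.fst‖ ^ 2 + ‖v.1.snd‖ ^ 2 := WithLp.prod_norm_sq_eq_of_L2 v.1
  rw [h1Form_apply, real_inner_self_eq_norm_sq, mul_assoc, ← sq, hn,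
    inv_mul_le_iff₀ (by positivity)]
  nlinarith

/-- Well-posedness: the solutions correspond to those of a coercive variational problem on
`H¹(Ω)`. -/
theorem existsUnique_isSolution (hΩ : IsLipschitzDomain Ω) {α : ℝ} (hα : 0 ≤ α) (f : L2 Ω) :
    ∃! w : L2Vec Ω × L2 Ω, IsSolution Ω α f w.1 w.2 := by
  have := hΩ.isFiniteMeasure
  have hm := hΩ.volume_real_pos
  obtain ⟨C, hC0, hC⟩ := exists_poincare hΩ
  have hcoer : IsCoercive (h1Form Ω (reaction Ω α)) := by
    refine isCoercive_h1Form hC0 (fun p G h => (hC p G h).trans ?_) fun p => ?_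
    · gcongr
      exact le_inner_reaction_self hm hα p
    · exact le_trans (by positivity) (le_inner_reaction_self hm hα p)
  have : CompleteSpace (H1 Ω) := by unfold H1; infer_instance
  -- `F` represents the functional `w ↦ ∫ f w` on `H¹(Ω)`.
  set F : H1 Ω := (H1 Ω).orthogonalProjectionOnto (WithLp.toLp 2 (f, 0)) with hF
  have hFin : ∀ w : H1 Ω, inner ℝ F w = inner ℝ f w.1.fst := fun w => by
    rw [hF, Submodule.inner_orthogonalProjectionOnto_eq_of_mem_right, WithLp.prod_inner_apply]
    simp
  set L := hcoer.continuousLinearEquivOfBilin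
  have key : ∀ v w : H1 Ω, inner ℝ (L v) w - inner ℝ F w
      = -(inner ℝ (-v.1.snd) w.1.snd + inner ℝ (f - reaction Ω α v.1.fst) w.1.fst) := fun v w => by
    rw [hcoer.continuousLinearEquivOfBilin_apply, h1Form_apply, hFin, inner_sub_left,
      inner_neg_left]
    ring
  have hsol : ∀ v : H1 Ω, IsSolution Ω α f (-v.1.snd) v.1.fst ↔ L v = F := fun v => by
    rw [isSolution_iff hΩ.isOpen, mem_HDivZero_iff hΩ.isOpen, neg_neg]
    constructor
    · rintro ⟨-, h⟩
      refine ext_inner_right ℝ fun w => ?_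
      rw [← sub_eq_zero, key, h _ _ (mem_H1_iff.1 w.2), neg_zero]
    · refine fun h => ⟨mem_H1_iff.1 v.2, fun q H hq => ?_⟩
      have e := key v ⟨WithLp.toLp 2 (q, H), mem_H1_iff.2 hq⟩
      rw [h, sub_self] at e
      exact neg_eq_zero.1 e.symm
  refine ⟨(-(L.symm F).1.snd, (L.symm F).1.fst), (hsol _).2 (L.apply_symm_apply F), ?_⟩
  rintro ⟨u, p⟩ h
  have hv : WithLp.toLp 2 (p, -u) ∈ H1 Ω := mem_H1_iff.2 ((isSolution_iff hΩ.isOpen).1 h).1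
  have e : L ⟨_, hv⟩ = F := (hsol ⟨_, hv⟩).1 (by simpa using h)
  rw [← e, L.symm_apply_apply]
  simp

/-! ### The a priori bound and the dual norms -/

/-- The a priori bound, by testing the variational equation with `p` itself. -/
theorem IsSolution.norm_le (hΩ : IsLipschitzDomain Ω) {C : ℝ} (hC0 : 0 ≤ C)
    (hC : ∀ (p : L2 Ω) (G : L2Vec Ω), IsWeakGrad Ω p G →
      ‖p‖ ^ 2 ≤ C * ‖G‖ ^ 2 + (volume.real Ω)⁻¹ * (∫ x in Ω, p x) ^ 2)
    {α : ℝ} (hα : 0 ≤ α) (hα1 : α ≤ 1) {f : L2 Ω} {u : L2Vec Ω} {p : L2 Ω}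
    (h : IsSolution Ω α f u p) :
    divNorm Ω u + (1 + Real.sqrt α) * ‖p‖ ≤ 5 * (C + 1) * ‖f‖ := by
  have := hΩ.isFiniteMeasure
  have hm := hΩ.volume_real_pos
  obtain ⟨hp, hu, hdiv⟩ := (isSolution_iff hΩ.isOpen).1 h
  set M := C + 1 with hM
  have hM1 : 1 ≤ M := by linarith
  have hf := norm_nonneg f
  have hpoin := hC p (-u) hp
  rw [norm_neg] at hpoin
  have hT := le_inner_reaction_self hm hα p
  have hT0 : 0 ≤ (volume.real Ω)⁻¹ * (∫ x in Ω, p x) ^ 2 := by positivity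
  have henergy : ‖u‖ ^ 2 + inner ℝ (reaction Ω α p) p = inner ℝ f p := by
    have e := (mem_HDivZero_iff hΩ.isOpen).1 ⟨hu, hdiv⟩ p (-u) hp
    rw [inner_neg_right, real_inner_self_eq_norm_sq, inner_sub_left] at e
    linarith
  have hCS := real_inner_le_norm f p
  have hpM : ‖p‖ ≤ M * ‖f‖ := by
    have h1 : ‖p‖ * ‖p‖ ≤ M * ‖f‖ * ‖p‖ := by nlinarith [sq_nonneg ‖u‖]
    rcases (norm_nonneg p).eq_or_lt with h0 | h0
    · rw [← h0]
      positivity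
    · exact le_of_mul_le_mul_right h1 h0
  have huM : ‖u‖ ≤ M * ‖f‖ := by
    refine (sq_le_sq₀ (norm_nonneg _) (by positivity)).1 ?_
    calc ‖u‖ ^ 2 ≤ ‖f‖ * ‖p‖ := by linarith
      _ ≤ (M * ‖f‖) * (M * ‖f‖) := by
        gcongr
        nlinarith
      _ = (M * ‖f‖) ^ 2 := by ring
  have hD : ‖weakDiv Ω u‖ ≤ 2 * (M * ‖f‖) := by
    rw [hdiv]
    have h1 := norm_sub_le f (reaction Ω α p)
    have h2 := norm_reaction_le hm hα hα1 p
    nlinarith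
  have hdn : divNorm Ω u ≤ ‖u‖ + ‖weakDiv Ω u‖ :=
    Real.sqrt_le_iff.2 ⟨by positivity,
      by nlinarith [mul_nonneg (norm_nonneg u) (norm_nonneg (weakDiv Ω u))]⟩
  have hsq : (1 + Real.sqrt α) * ‖p‖ ≤ 2 * (M * ‖f‖) := by
    have : Real.sqrt α ≤ 1 := Real.sqrt_le_one.2 hα1
    calc (1 + Real.sqrt α) * ‖p‖ ≤ (1 + 1) * (M * ‖f‖) := by gcongr
      _ = 2 * (M * ‖f‖) := by ring
  linarith

/-- The function `f` is itself admissible in the supremum that defines its dual norm, and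
`qNorm Ω f = √2 ‖f‖ ≤ 2 ‖f‖`. -/
theorem norm_le_two_mul_dualNorm {Q : Set (L2 Ω)} {f : L2 Ω} (hf : f ∈ Q) :
    ‖f‖ ≤ 2 * dualNorm Ω Q f := by
  have hle : ∀ q : L2 Ω, ‖q‖ ≤ qNorm Ω q := fun q =>
    Real.le_sqrt_of_sq_le (by linarith [sq_nonneg ‖q‖])
  have hle2 : qNorm Ω f ≤ 2 * ‖f‖ :=
    Real.sqrt_le_iff.2 ⟨by positivity, by nlinarith [sq_nonneg ‖f‖]⟩
  have hbdd : BddAbove {t : ℝ | ∃ q ∈ Q, q ≠ 0 ∧ t = |∫ x in Ω, f x * q x| / qNorm Ω q} := by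
    refine ⟨‖f‖, ?_⟩
    rintro t ⟨q, -, hq, rfl⟩
    have hq0 : 0 < ‖q‖ := norm_pos_iff.2 hq
    rw [div_le_iff₀ (hq0.trans_le (hle q)), ← L2_inner_eq]
    exact (abs_real_inner_le_norm f q).trans (by gcongr; exact hle q)
  by_cases h0 : f = 0
  · rw [h0, norm_zero]
    refine mul_nonneg zero_le_two (Real.sSup_nonneg ?_)
    rintro t ⟨q, -, -, rfl⟩
    exact div_nonneg (abs_nonneg _) (Real.sqrt_nonneg _)
  · have hf0 : 0 < ‖f‖ := norm_pos_iff.2 h0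
    have h := le_csSup hbdd ⟨f, hf, h0, rfl⟩
    rw [← L2_inner_eq, real_inner_self_eq_norm_sq, abs_of_nonneg (sq_nonneg _)] at h
    have h2 : ‖f‖ / 2 ≤ ‖f‖ ^ 2 / qNorm Ω f := by
      rw [div_le_div_iff₀ two_pos (hf0.trans_le (hle f))]
      nlinarith
    have h3 : ‖f‖ / 2 ≤ dualNorm Ω Q f := h2.trans h
    linarith

end MixedNeumann

theorem mainTheorem3 (d : ℕ) (hd : d = 2 ∨ d = 3) (Ω : Set (MixedNeumann.E d))
    (hΩ : MixedNeumann.IsLipschitzDomain Ω) :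
    ∃ C : ℝ, 0 < C ∧ ∀ α : ℝ, 0 ≤ α → α ≤ 1 → ∀ f : MixedNeumann.L2 Ω,
      (∃! w : MixedNeumann.L2Vec Ω × MixedNeumann.L2 Ω,
        MixedNeumann.IsSolution Ω α f w.1 w.2) ∧
      ∀ (u : MixedNeumann.L2Vec Ω) (p : MixedNeumann.L2 Ω),
        MixedNeumann.IsSolution Ω α f u p →
          MixedNeumann.divNorm Ω u + (1 + Real.sqrt α) * ‖p‖
            ≤ C * MixedNeumann.dualNorm Ω Set.univ f ∧
          (f ∈ MixedNeumann.zeroMean Ω →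
            MixedNeumann.divNorm Ω u + (1 + Real.sqrt α) * ‖p‖
              ≤ C * MixedNeumann.dualNorm Ω (MixedNeumann.zeroMean Ω) f) := by
  obtain ⟨C, hC0, hC⟩ := MixedNeumann.exists_poincare hΩ
  refine ⟨10 * (C + 1), by positivity, fun α hα hα1 f =>
    ⟨MixedNeumann.existsUnique_isSolution hΩ hα f, fun u p h => ?_⟩⟩
  have hb := h.norm_le hΩ hC0 hC hα hα1
  have hdual : ∀ Q : Set (MixedNeumann.L2 Ω), f ∈ Q →
      5 * (C + 1) * ‖f‖ ≤ 10 * (C + 1) * MixedNeumann.dualNorm Ω Q f := fun Q hf => by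
    calc 5 * (C + 1) * ‖f‖ ≤ 5 * (C + 1) * (2 * MixedNeumann.dualNorm Ω Q f) := by
          gcongr
          exact MixedNeumann.norm_le_two_mul_dualNorm hf
      _ = 10 * (C + 1) * MixedNeumann.dualNorm Ω Q f := by ring
  exact ⟨hb.trans (hdual _ (Set.mem_univ f)), fun hf => hb.trans (hdual _ hf)⟩
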